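/- **Theorem (Absolutization).** All systems are finite-dimensional with distinguished bases; a null system is one-dimensional. *Finite resources.* A finite dynamic resource $(\mathcal N:\omega)$ is a quantum operation (CPTP map) $\mathcal N:A'\to AB$ from Alice's input $A'=A^{\rm rel}A^{\rm abs}$ to a system shared by Alice ($A$) and Bob ($B$), with a test state $\omega$ on $A^{\rm rel}$. It is proper, written $\mathcal N$, if $A^{\rm rel}$ is null, and relative if $A^{\rm abs}$ is null. Tensor products are $(\mathcal N_1:\omega_1)\otimes(\mathcal N_2:\omega_2)=(\mathcal N_1\otimes\mathcal N_2:\omega_1\otimes\omega_2)$. For operations $\mathcal M,\mathcal N$ on $A'$ put $\|\mathcal M-\mathcal N\|_\omega=\sup_\xi\|(\mathrm{id}^R\otimes\mathcal M)\xi-(\mathrm{id}^R\otimes\mathcal N)\xi\|_1$, the supremum being over all reference systems $R$ and all states $\xi^{RA'}$ with $\operatorname{tr}_{RA^{\rm abs}}\xi=\omega$ (extensions of $\omega$), where $\|M\|_1=\operatorname{tr}\sqrt{M^\dagger M}$; this is the distance of $(\mathcal M:\omega)$ and $(\mathcal N:\omega)$. *Protocols.* A depth-$\ell$ resource is an unordered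 collection of $\ell$ finite resources $(\mathcal N_i:\omega_i)$, $\mathcal N_i:A_i'\to A_iB_i$; $\alpha^{\times k}$ is the collection of $k$ copies of $\alpha$, and $\mathbf S[\alpha]$ is the tensor product of the members of $\alpha$. A protocol $\mathbf P$ on it, creating $\mathbf P[\alpha]=(\mathcal P:\Omega)$ with $\mathcal P:A'\to AB$, is given by a permutation $\pi$ of $\{1,\dots,\ell\}$ and local operations as follows. Alice performs an operation $A'\to A_0A_0^{\rm aux}$; for $i=1,\dots,\ell$ she performs an isometry from what she then holds (the output left to her by the previous resource and her auxiliary system) to the input system of $\mathcal N_{\pi(i)}$ and a new auxiliary system, after which $\mathcal N_{\pi(i)}$ is applied; finally Alice performs an operation from what she holds to $A$ and Bob performs an operation from all his received outputs to $B$. The protocol is $\eta$-valid if, for every extension $\xi$ of $\Omega$ and every $i$, the state just before the application of $\mathcal N_{\pi(i)}$, restricted to the test system of that resource, is within trace norm $\eta$ of $\omega_{\pi(i)}$. *Asymptotic resources.* For sequences $\alpha=(\alpha_n)$, $\beta=(\beta_n)$ of finite resources, $\alpha\ge\beta$ means: for every $\delta>0$ there is an integer $k\ge1$ such that for every $\epsilon>0$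 there is $N$ such that for all $n\ge N$ there is an $\epsilon$-valid protocol $\mathbf P$ on $(\alpha_{\lfloor n/k\rfloor})^{\times k}$ with $\|\mathbf P[(\alpha_{\lfloor n/k\rfloor})^{\times k}]-\mathbf S[\beta_{\lfloor(1-\delta)n\rfloor}]\|\le\epsilon$ (negative indices being read as $0$). Resources are regarded as equal, $\alpha=\beta$, if $\alpha\ge\beta$ and $\beta\ge\alpha$. Let $\langle\mathcal N:\omega\rangle=((\mathcal N:\omega)^{\otimes n})_n$. Let $\tau=\frac12\mathbf 1$ be the maximally mixed qubit state; let $\mathrm{id}_2:A'\to B$ be the perfect qubit channel, $\Delta_2:A'\to AB$ the coherent channel given by the isometry $\sum_{x}|x\rangle^A|x\rangle^B\langle x|^{A'}$, and $\overline{\mathrm{id}}_2:A'\to B$ the perfect classical bit channel (completely dephasing, with Kraus operators $|x\rangle^B\langle x|^{A'}$). Put $[q\to q]=\langle\mathrm{id}_2\rangle$, $[q\to qq]=\langle\Delta_2\rangle$, $[c\to c]=\langle\overline{\mathrm{id}}_2\rangle$ for the proper resources, and $[q\to q:\tau]=\langle\mathrm{id}_2:\tau\rangle$, $[q\to qq:\tau]=\langle\Delta_2:\tau\rangle$,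 $[c\to c:\tau]=\langle\overline{\mathrm{id}}_2:\tau\rangle$ for the relative ones. Then 1. $[q\to q:\tau]=[q\to q]$; 2. $[q\to qq:\tau]=[q\to qq]$; 3. $[c\to c:\tau]=[c\to c]$. -/

import Mathlib

open scoped Matrix Kronecker ComplexOrder ENNReal

namespace ResourceTheory

noncomputable section

/-! ### States

A finite quantum system with a distinguished basis is a finite type `A` (the label set of the
basis); operators on its Hilbert space are matrices `Matrix A A ℂ`, a joint system is a product
of types, and a null (one-dimensional) system is `Unit`. -/

/-- A quantum state (density operator) of the system `A`. -/
structure State (A : Type) [Fintype A] where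
  mat : Matrix A A ℂ
  posSemidef : mat.PosSemidef
  trace_eq_one : mat.trace = 1

/-- The partial trace over the first tensor factor. -/
def traceFst {A B : Type} [Fintype A] (ρ : Matrix (A × B) (A × B) ℂ) : Matrix B B ℂ :=
  Matrix.of fun b b' => ∑ a, ρ (a, b) (a, b')

/-- The partial trace over the second tensor factor. -/
def traceSnd {A B : Type} [Fintype B] (ρ : Matrix (A × B) (A × B) ℂ) : Matrix A A ℂ :=
  Matrix.of fun a a' => ∑ b, ρ (a, b) (a', b)

/-- The trace norm `‖M‖₁ = tr √(M† M)`, that is, the sum of the square roots of the eigenvalues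
of `M† M`. -/
def traceNorm {A : Type} [Fintype A] [DecidableEq A] (M : Matrix A A ℂ) : ℝ :=
  ∑ i, √((Matrix.isHermitian_conjTranspose_mul_self M).eigenvalues i)

/-- The one-dimensional state. -/
def State.unit : State Unit where
  mat := 1
  posSemidef := Matrix.PosSemidef.one
  trace_eq_one := by simp

/-- The maximally mixed state `τ = 1 / d` of a `d`-dimensional system. -/
def State.maximallyMixed (A : Type) [Fintype A] [DecidableEq A] [Nonempty A] : State A where
  mat := (Fintype.card A : ℂ)⁻¹ • 1
  posSemidef := Matrix.PosSemidef.one.smul (by positivity)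
  trace_eq_one := by simp

/-- The tensor product of two states. -/
def State.prod {A B : Type} [Fintype A] [Fintype B] (ρ : State A) (σ : State B) :
    State (A × B) where
  mat := ρ.mat ⊗ₖ σ.mat
  posSemidef := ρ.posSemidef.kronecker σ.posSemidef
  trace_eq_one := by rw [Matrix.trace_kronecker, ρ.trace_eq_one, σ.trace_eq_one, one_mul]

/-- The `n`-fold tensor power of a state. -/
def State.pow {A : Type} [Fintype A] (ρ : State A) (n : ℕ) : State (Fin n → A) where
  mat := Matrix.of fun a a' => ∏ i, ρ.mat (a i) (a' i)
  posSemidef := by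
    classical
    obtain ⟨S, hS⟩ : ∃ S : Matrix A A ℂ, ρ.mat = Sᴴ * S := by
      open scoped MatrixOrder in
      exact CStarAlgebra.nonneg_iff_eq_star_mul_self.mp ρ.posSemidef.nonneg
    have h : (Matrix.of fun a a' : Fin n → A => ∏ i, ρ.mat (a i) (a' i))
        = (Matrix.of fun a a' : Fin n → A => ∏ i, S (a i) (a' i))ᴴ
          * Matrix.of fun a a' : Fin n → A => ∏ i, S (a i) (a' i) := by
      ext a a'
      simp only [Matrix.of_apply, Matrix.mul_apply, Matrix.conjTranspose_apply, hS, star_prod,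
        ← Finset.prod_mul_distrib]
      exact Fintype.prod_sum fun i j => star (S j (a i)) * S j (a' i)
    rw [h]
    exact Matrix.posSemidef_conjTranspose_mul_self _
  trace_eq_one := by
    have h : ∑ a, ρ.mat a a = 1 := ρ.trace_eq_one
    have h' := Fintype.prod_sum fun (_ : Fin n) (a : A) => ρ.mat a a
    simp only [h, Finset.prod_const_one] at h'
    exact h'.symm

/-! ### Quantum operations -/

/-- A quantum operation (completely positive trace preserving map) from `A` to `B`, given by a
Kraus representation. The representation is not unique; everything below depends only on the
map `Channel.apply`. -/
structure Channel (A B : Type) [Fintype A] [DecidableEq A] [Fintype B] where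
  Idx : Type
  [fintypeIdx : Fintype Idx]
  kraus : Idx → Matrix B A ℂ
  tracePreserving : ∑ x, (kraus x)ᴴ * kraus x = 1

attribute [instance] Channel.fintypeIdx

namespace Channel

variable {A B C D : Type} [Fintype A] [DecidableEq A] [Fintype B] [DecidableEq B]
  [Fintype C] [DecidableEq C] [Fintype D] [DecidableEq D]

/-- The action `ρ ↦ ∑ₓ Kₓ ρ Kₓ†` of a quantum operation. -/
def apply (N : Channel A B) (ρ : Matrix A A ℂ) : Matrix B B ℂ :=
  ∑ x, N.kraus x * ρ * (N.kraus x)ᴴ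

/-- The operation `ρ ↦ V ρ V†` of an isometry `V`. -/
def ofIsometry (V : Matrix B A ℂ) (hV : Vᴴ * V = 1) : Channel A B where
  Idx := Unit
  kraus := fun _ => V
  tracePreserving := by simpa using hV

/-- The identity operation. -/
def id (A : Type) [Fintype A] [DecidableEq A] : Channel A A :=
  ofIsometry 1 (by simp)

/-- Relabelling of the basis, used only to rearrange tensor factors. -/
def ofEquiv (e : A ≃ B) : Channel A B :=
  ofIsometry (Matrix.of fun b a => if b = e a then 1 else 0) (by
    ext a a'
    simp [Matrix.mul_apply, Matrix.one_apply, eq_comm])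

/-- Composition: first `N`, then `M`. -/
def comp (M : Channel B C) (N : Channel A B) : Channel A C where
  Idx := M.Idx × N.Idx
  kraus := fun x => M.kraus x.1 * N.kraus x.2
  tracePreserving := by
    rw [Fintype.sum_prod_type_right]
    have h (y : N.Idx) : ∑ x : M.Idx, (M.kraus x * N.kraus y)ᴴ * (M.kraus x * N.kraus y)
        = (N.kraus y)ᴴ * N.kraus y := by
      have : ∀ x, (M.kraus x * N.kraus y)ᴴ * (M.kraus x * N.kraus y)
          = (N.kraus y)ᴴ * (((M.kraus x)ᴴ * M.kraus x) * N.kraus y) := fun x => by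
        simp only [Matrix.conjTranspose_mul, Matrix.mul_assoc]
      simp only [this]
      rw [← Matrix.mul_sum, ← Matrix.sum_mul, M.tracePreserving, Matrix.one_mul]
    simp only [h]
    exact N.tracePreserving

/-- The tensor product of two quantum operations. -/
def prod (M : Channel A B) (N : Channel C D) : Channel (A × C) (B × D) where
  Idx := M.Idx × N.Idx
  kraus := fun x => M.kraus x.1 ⊗ₖ N.kraus x.2
  tracePreserving := by
    simp only [Matrix.conjTranspose_kronecker, ← Matrix.mul_kronecker_mul]
    rw [Fintype.sum_prod_type, ← Matrix.one_kronecker_one, ← M.tracePreserving,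
      ← N.tracePreserving]
    ext ⟨a, c⟩ ⟨a', c'⟩
    simp [Matrix.sum_apply, Finset.sum_mul_sum]

/-- The `n`-fold tensor power of an operation from a two-part system to a two-part system, with
the corresponding parts collected. -/
def pow (N : Channel (A × B) (C × D)) (n : ℕ) :
    Channel ((Fin n → A) × (Fin n → B)) ((Fin n → C) × (Fin n → D)) where
  Idx := Fin n → N.Idx
  kraus := fun x => Matrix.of fun o p => ∏ i, N.kraus (x i) (o.1 i, o.2 i) (p.1 i, p.2 i)
  tracePreserving := by
    have h (a a' : A) (b b' : B) : ∑ x, ∑ o, star (N.kraus x o (a, b)) * N.kraus x o (a', b')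
        = if (a, b) = (a', b') then 1 else 0 := by
      have := congrFun (congrFun N.tracePreserving (a, b)) (a', b')
      simpa only [Matrix.sum_apply, Matrix.mul_apply, Matrix.conjTranspose_apply,
        Matrix.one_apply] using this
    ext ⟨a, b⟩ ⟨a', b'⟩
    simp only [Matrix.sum_apply, Matrix.mul_apply, Matrix.conjTranspose_apply, Matrix.of_apply,
      star_prod, ← Finset.prod_mul_distrib]
    have e (x : Fin n → N.Idx) :
        ∑ o : (Fin n → C) × (Fin n → D), ∏ i, star (N.kraus (x i) (o.1 i, o.2 i) (a i, b i))
          * N.kraus (x i) (o.1 i, o.2 i) (a' i, b' i)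
        = ∏ i, ∑ o, star (N.kraus (x i) o (a i, b i)) * N.kraus (x i) o (a' i, b' i) := by
      rw [Fintype.prod_sum]
      exact Fintype.sum_equiv (Equiv.arrowProdEquivProdArrow (Fin n) (fun _ => C) fun _ => D).symm
        _ _ fun _ => rfl
    simp only [e]
    rw [← Fintype.prod_sum fun i x =>
      ∑ o, star (N.kraus x o (a i, b i)) * N.kraus x o (a' i, b' i)]
    simp only [h, Matrix.one_apply, Prod.mk.injEq]
    by_cases hab : a = a' ∧ b = b'
    · simp [hab]
    · rw [if_neg hab]
      have : ∃ i, ¬ (a i = a' i ∧ b i = b' i) := by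
        by_contra! hc
        exact hab ⟨funext fun i => (hc i).1, funext fun i => (hc i).2⟩
      obtain ⟨i, hi⟩ := this
      exact Finset.prod_eq_zero (Finset.mem_univ i) (if_neg hi)

end Channel

/-- The distance `‖M - N‖_ω` of two quantum operations with input `R' × A'` relative to a state
`ω` of the subsystem `R'`: the supremum of `‖(id_R ⊗ M) ξ - (id_R ⊗ N) ξ‖₁` over all reference
systems `R` and all states `ξ` of `R`, `R'`, `A'` that extend `ω`. -/
def relDist {R' A' B : Type} [Fintype R'] [DecidableEq R'] [Fintype A'] [DecidableEq A']
    [Fintype B] [DecidableEq B] (M N : Channel (R' × A') B) (ω : State R') : ℝ≥0∞ :=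
  ⨆ (R : Type) (_ : Fintype R) (_ : DecidableEq R) (ξ : State (R × (R' × A')))
    (_ : traceSnd (traceFst ξ.mat) = ω.mat),
    ENNReal.ofReal (traceNorm
      (((Channel.id R).prod M).apply ξ.mat - ((Channel.id R).prod N).apply ξ.mat))

/-! ### Finite resources -/

/-- A finite (depth-1) dynamic resource `(N : ω)`: an operation `N : A' → A B` whose input
`A' = Rel × Abs` belongs to Alice and whose output is shared between Alice (`OutA`) and Bob
(`OutB`), with a test state `ω` on the subsystem `Rel` of the input. -/
structure FiniteResource where
  Rel : Type
  Abs : Type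
  OutA : Type
  OutB : Type
  [fintypeRel : Fintype Rel]
  [fintypeAbs : Fintype Abs]
  [fintypeOutA : Fintype OutA]
  [fintypeOutB : Fintype OutB]
  [decEqRel : DecidableEq Rel]
  [decEqAbs : DecidableEq Abs]
  [decEqOutA : DecidableEq OutA]
  [decEqOutB : DecidableEq OutB]
  op : Channel (Rel × Abs) (OutA × OutB)
  test : State Rel

attribute [instance] FiniteResource.fintypeRel FiniteResource.fintypeAbs
  FiniteResource.fintypeOutA FiniteResource.fintypeOutB FiniteResource.decEqRel
  FiniteResource.decEqAbs FiniteResource.decEqOutA FiniteResource.decEqOutB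

namespace FiniteResource

variable {A' A B : Type} [Fintype A'] [DecidableEq A'] [Fintype A] [DecidableEq A]
  [Fintype B] [DecidableEq B]

/-- The proper dynamic resource `N`: the test system is null. -/
def proper (N : Channel A' (A × B)) : FiniteResource where
  Rel := Unit
  Abs := A'
  OutA := A
  OutB := B
  op := N.comp (Channel.ofEquiv (Equiv.punitProd A'))
  test := State.unit

/-- The relative dynamic resource `(N : ω)`: the test system is the whole input. -/
def relative (N : Channel A' (A × B)) (ω : State A') : FiniteResource where
  Rel := A'
  Abs := Unit
  OutA := A
  OutB := B
  op := N.comp (Channel.ofEquiv (Equiv.prodPUnit A'))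
  test := ω

/-- The trivial resource, on null systems. -/
def trivial : FiniteResource where
  Rel := Unit
  Abs := Unit
  OutA := Unit
  OutB := Unit
  op := Channel.id (Unit × Unit)
  test := State.unit

/-- The tensor product `(N₁ ⊗ N₂ : ω₁ ⊗ ω₂)`. -/
def tensor (r s : FiniteResource) : FiniteResource where
  Rel := r.Rel × s.Rel
  Abs := r.Abs × s.Abs
  OutA := r.OutA × s.OutA
  OutB := r.OutB × s.OutB
  op := (Channel.ofEquiv (Equiv.prodProdProdComm r.OutA r.OutB s.OutA s.OutB)).comp
    ((r.op.prod s.op).comp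
      (Channel.ofEquiv (Equiv.prodProdProdComm r.Rel s.Rel r.Abs s.Abs)))
  test := r.test.prod s.test

/-- The tensor power `(N : ω)^{⊗ n}`. -/
def pow (r : FiniteResource) (n : ℕ) : FiniteResource where
  Rel := Fin n → r.Rel
  Abs := Fin n → r.Abs
  OutA := Fin n → r.OutA
  OutB := Fin n → r.OutB
  op := r.op.pow n
  test := r.test.pow n

end FiniteResource

/-- A finite depth-`ℓ` resource, a collection of `ℓ` component resources. The order of the list
carries no meaning: a protocol may use the components in any order. -/
abbrev DepthResource := List FiniteResource

/-- The depth-`kℓ` resource `α^{× k}` consisting of `k` copies of a depth-`ℓ` resource. -/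
def DepthResource.times (k : ℕ) (α : DepthResource) : DepthResource :=
  (List.replicate k α).flatten

/-- The result `S[α]` of the standard protocol: the tensor product of all components. -/
def DepthResource.standard : DepthResource → FiniteResource
  | [] => FiniteResource.trivial
  | [r] => r
  | r :: s :: l => r.tensor (DepthResource.standard (s :: l))

/-! ### Protocols -/

/-- The part of a protocol that remains to be carried out, when the resources in the list are
still to be used (in this order), Alice holds the system `M` (the output of the last resource
and her auxiliary system), and Bob holds the system `W` (all outputs received so far).

* `step`: Alice performs a local isometry `M → A'ᵢ A^aux`, then the next resource
  is applied to `A'ᵢ`, producing an output for Alice and one for Bob.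
* `finish`: Alice and Bob perform final local operations. -/
inductive Steps (OA OB : Type) [Fintype OA] [DecidableEq OA] [Fintype OB] [DecidableEq OB] :
    List FiniteResource → (M W : Type) → [Fintype M] → [DecidableEq M] →
      [Fintype W] → [DecidableEq W] → Type 1
  | finish {M W : Type} [Fintype M] [DecidableEq M] [Fintype W] [DecidableEq W]
      (encode : Channel M OA) (decode : Channel W OB) : Steps OA OB [] M W
  | step {M W : Type} [Fintype M] [DecidableEq M] [Fintype W] [DecidableEq W]
      {r : FiniteResource} {rs : List FiniteResource}
      (Aux : Type) [Fintype Aux] [DecidableEq Aux]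
      (V : Matrix ((r.Rel × r.Abs) × Aux) M ℂ) (isometry : Vᴴ * V = 1)
      (next : Steps OA OB rs (r.OutA × Aux) (r.OutB × W)) : Steps OA OB (r :: rs) M W

namespace Steps

variable {OA OB : Type} [Fintype OA] [DecidableEq OA] [Fintype OB] [DecidableEq OB]

/-- Alice's local isometry `M → A' A^aux`, with the bystanding systems collected on the right. -/
def encodeStep {r : FiniteResource} {M W Aux : Type} [Fintype M] [DecidableEq M]
    [Fintype W] [DecidableEq W] [Fintype Aux] [DecidableEq Aux]
    (V : Matrix ((r.Rel × r.Abs) × Aux) M ℂ) (hV : Vᴴ * V = 1) :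
    Channel (M × W) ((r.Rel × r.Abs) × (Aux × W)) :=
  (Channel.ofEquiv (Equiv.prodAssoc (r.Rel × r.Abs) Aux W)).comp
    ((Channel.ofIsometry V hV).prod (Channel.id W))

/-- The application of a resource to its input `A'`, with the outputs handed to Alice and Bob. -/
def useStep (r : FiniteResource) (Aux W : Type) [Fintype Aux] [DecidableEq Aux]
    [Fintype W] [DecidableEq W] :
    Channel ((r.Rel × r.Abs) × (Aux × W)) ((r.OutA × Aux) × (r.OutB × W)) :=
  (Channel.ofEquiv (Equiv.prodProdProdComm r.OutA r.OutB Aux W)).comp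
    (r.op.prod (Channel.id (Aux × W)))

/-- The overall quantum operation carried out by the remaining steps. -/
def channel {rs : List FiniteResource} {M W : Type} [Fintype M] [DecidableEq M]
    [Fintype W] [DecidableEq W] : Steps OA OB rs M W → Channel (M × W) (OA × OB)
  | finish encode decode => encode.prod decode
  | step (r := r) Aux V hV next =>
      next.channel.comp ((useStep r Aux W).comp (encodeStep V hV))

/-- `η`-validity of the remaining steps when the present joint state of Alice and Bob is `σ`:
before each use of a resource the restriction of the state to its test system is `η`-close to
its test state. -/
def Valid (η : ℝ) {rs : List FiniteResource} {M W : Type} [Fintype M] [DecidableEq M]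
    [Fintype W] [DecidableEq W] :
    Steps OA OB rs M W → Matrix (M × W) (M × W) ℂ → Prop
  | finish _ _, _ => True
  | step (r := r) Aux V hV next, σ =>
      traceNorm (traceSnd (traceSnd ((encodeStep V hV).apply σ)) - r.test.mat) ≤ η ∧
        next.Valid η ((useStep r Aux W).apply ((encodeStep V hV).apply σ))

end Steps

/-- A protocol consuming the resource `α`, with input system `In` of Alice and output systems
`OA` of Alice and `OB` of Bob: a choice of an order in which the components of `α` are used,
an initial local operation of Alice, and the subsequent steps. -/
structure Protocol (α : DepthResource) (In OA OB : Type) [Fintype In] [DecidableEq In]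
    [Fintype OA] [DecidableEq OA] [Fintype OB] [DecidableEq OB] where
  order : List FiniteResource
  perm : order.Perm α
  Mem : Type
  [fintypeMem : Fintype Mem]
  [decEqMem : DecidableEq Mem]
  init : Channel In Mem
  steps : Steps OA OB order Mem Unit

attribute [instance] Protocol.fintypeMem Protocol.decEqMem

namespace Protocol

variable {α : DepthResource} {In OA OB : Type} [Fintype In] [DecidableEq In]
    [Fintype OA] [DecidableEq OA] [Fintype OB] [DecidableEq OB]

/-- The initial operation; Bob starts with a null system. -/
def start (P : Protocol α In OA OB) : Channel In (P.Mem × Unit) :=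
  (Channel.ofEquiv (Equiv.prodPUnit P.Mem).symm).comp P.init

/-- The quantum operation which the protocol simulates from the consumed resource. -/
def channel (P : Protocol α In OA OB) : Channel In (OA × OB) :=
  P.steps.channel.comp P.start

/-- A protocol whose created resource has the test state `Ω` is `η`-valid if, for every
extension `ξ` of `Ω`, each consumed resource is applied to an input whose restriction to the
test system is `η`-close to the test state of that resource. (The reference system `R` plays no
role in these restrictions, and is traced out at once.) -/
def Valid {Rel Abs : Type} [Fintype Rel] [DecidableEq Rel] [Fintype Abs] [DecidableEq Abs]
    (P : Protocol α (Rel × Abs) OA OB) (Ω : State Rel) (η : ℝ) : Prop :=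
  ∀ (R : Type) [Fintype R] (ξ : State (R × (Rel × Abs))),
    traceSnd (traceFst ξ.mat) = Ω.mat →
      P.steps.Valid η (P.start.apply (traceFst ξ.mat))

end Protocol

/-! ### Asymptotic resources -/

/-- A sequence of finite resources `(α_n)_n`. The inequality below makes sense for every such
sequence; it is used here only for i.i.d. sequences. -/
abbrev ResourceSequence := ℕ → DepthResource

/-- The i.i.d. resource `⟨N : ω⟩ = ((N : ω)^{⊗ n})_n`. -/
def iid (r : FiniteResource) : ResourceSequence := fun n => [r.pow n]

/-- The asymptotic resource inequality `α ≥ β`: for every inefficiency `δ` there is a number `k`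
of blocks such that for every `ε` and all large `n` some `ε`-valid protocol on
`(α_{⌊n/k⌋})^{× k}` simulates `S[β_{⌊(1-δ)n⌋}]` up to distance `ε`. -/
def ResourceSequence.Ge (α β : ResourceSequence) : Prop :=
  ∀ δ : ℝ, 0 < δ → ∃ k : ℕ, 0 < k ∧ ∀ ε : ℝ, 0 < ε → ∃ n₀ : ℕ, ∀ n : ℕ, n₀ ≤ n →
    let target := DepthResource.standard (β ⌊(1 - δ) * n⌋₊)
    ∃ P : Protocol (DepthResource.times k (α (n / k)))
        (target.Rel × target.Abs) target.OutA target.OutB,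
      P.Valid target.test ε ∧
        relDist P.channel target.op target.test ≤ ENNReal.ofReal ε

/-- Equivalence (equality) of asymptotic resources: `α ≥ β` and `β ≥ α`. -/
def ResourceSequence.Equivalent (α β : ResourceSequence) : Prop :=
  α.Ge β ∧ β.Ge α

/-! ### The unit resources -/

/-- The perfect quantum channel `id_d : A' → B`. -/
def idChannel (d : ℕ) : Channel (Fin d) (Unit × Fin d) :=
  Channel.ofIsometry (Matrix.of fun o x => if o.2 = x then 1 else 0) (by
    ext a a'
    rw [Matrix.mul_apply, Fintype.sum_prod_type]
    by_cases h : a = a' <;> simp [Matrix.one_apply, h, eq_comm])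

/-- The coherent channel `Δ_d : A' → A B`, given by the isometry `∑ₓ |x⟩|x⟩⟨x|`. -/
def coherentChannel (d : ℕ) : Channel (Fin d) (Fin d × Fin d) :=
  Channel.ofIsometry (Matrix.of fun o x => if o.1 = x ∧ o.2 = x then 1 else 0) (by
    ext a a'
    rw [Matrix.mul_apply, Fintype.sum_prod_type]
    by_cases h : a = a' <;> simp [Matrix.one_apply, ite_and, h, eq_comm])

/-- The perfect classical channel `A' → B`, that is, the completely dephasing channel with Kraus
operators `|x⟩⟨x|`. -/
def classicalChannel (d : ℕ) : Channel (Fin d) (Unit × Fin d) where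
  Idx := Fin d
  kraus := fun y => Matrix.of fun o x => if o.2 = y ∧ x = y then 1 else 0
  tracePreserving := by
    ext a a'
    simp [Matrix.sum_apply, Matrix.mul_apply, Matrix.one_apply, Fintype.sum_prod_type, ite_and,
      eq_comm]

/-- `[q → q]`. -/
def qubit : ResourceSequence := iid (FiniteResource.proper (idChannel 2))

/-- `[q → qq]`. -/
def cobit : ResourceSequence := iid (FiniteResource.proper (coherentChannel 2))

/-- `[c → c]`. -/
def cbit : ResourceSequence := iid (FiniteResource.proper (classicalChannel 2))

/-- `[q → q : τ]`. -/
def qubitRel : ResourceSequence :=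
  iid (FiniteResource.relative (idChannel 2) (State.maximallyMixed (Fin 2)))

/-- `[q → qq : τ]`. -/
def cobitRel : ResourceSequence :=
  iid (FiniteResource.relative (coherentChannel 2) (State.maximallyMixed (Fin 2)))

/-- `[c → c : τ]`. -/
def cbitRel : ResourceSequence :=
  iid (FiniteResource.relative (classicalChannel 2) (State.maximallyMixed (Fin 2)))

end

end ResourceTheory

/-!
Each simulation is exact. If the input of a block undergoes the shift of the basis by a uniformly
random group element and the multiplication by a uniformly random character, its marginal is
maximally mixed, whatever the input was: this is the twirl by the Heisenberg group. The two keys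
are themselves sent through two further blocks, which are maximally mixed since the keys are
uniform, and the receivers use them to undo shift and phase. Validity restricts the marginal of
each block and not the joint state of the blocks, so the same pair of keys serves all `j` data
blocks: `j + 2` copies of the relative resource yield `j` copies of the proper one, and
`j / (j + 2) → 1`. Conversely, a proper resource has no test condition to violate.
-/

namespace ResourceTheory

noncomputable section

/-! ### Quantum operations as matrices -/

namespace Channel

variable {A B C D : Type} [Fintype A] [DecidableEq A] [Fintype B] [Fintype C] [Fintype D]

/-- The Liouville matrix of a quantum operation: the entry at `((b, b'), (a, a'))` is the
coefficient of `|b⟩⟨b'|` in the image of `|a⟩⟨a'|`. Unlike the Kraus operators it is determined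
by the map. -/
def liouville (N : Channel A B) : Matrix (B × B) (A × A) ℂ :=
  ∑ x, N.kraus x ⊗ₖ (N.kraus x).map (starRingEnd ℂ)

theorem liouville_apply (N : Channel A B) (b b' : B) (a a' : A) :
    N.liouville (b, b') (a, a') = ∑ x, N.kraus x b a * star (N.kraus x b' a') := by
  simp [liouville, Matrix.sum_apply]

theorem uncurry_apply (N : Channel A B) (ρ : Matrix A A ℂ) :
    Function.uncurry (N.apply ρ) = N.liouville *ᵥ Function.uncurry ρ := by
  ext ⟨b, b'⟩
  change N.apply ρ b b' = ∑ p, N.liouville (b, b') p * ρ p.1 p.2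
  simp only [apply, Matrix.sum_apply, Matrix.mul_apply, Matrix.conjTranspose_apply,
    Fintype.sum_prod_type_right, liouville_apply, Finset.sum_mul]
  rw [Finset.sum_comm]
  refine Finset.sum_congr rfl fun a' _ => ?_
  rw [Finset.sum_comm]
  exact Finset.sum_congr rfl fun a _ => Finset.sum_congr rfl fun x _ => mul_right_comm ..

theorem apply_congr {M N : Channel A B} (h : M.liouville = N.liouville) (ρ : Matrix A A ℂ) :
    M.apply ρ = N.apply ρ :=
  Function.uncurry_injective (by rw [uncurry_apply, uncurry_apply, h])

theorem liouville_ofIsometry (V : Matrix B A ℂ) (hV : Vᴴ * V = 1) :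
    (ofIsometry V hV).liouville = V ⊗ₖ V.map (starRingEnd ℂ) :=
  Fintype.sum_unique (ι := Unit) _

theorem liouville_comp [DecidableEq B] (M : Channel B C) (N : Channel A B) :
    (M.comp N).liouville = M.liouville * N.liouville := by
  simp only [liouville, Matrix.sum_mul, Matrix.mul_sum, ← Matrix.mul_kronecker_mul,
    ← Matrix.map_mul]
  exact Fintype.sum_prod_type_right
    fun k : M.Idx × N.Idx => (M.kraus k.1 * N.kraus k.2) ⊗ₖ
      (M.kraus k.1 * N.kraus k.2).map (starRingEnd ℂ)

theorem liouville_prod [DecidableEq C] (M : Channel A B) (N : Channel C D)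
    (y y' : B × D) (x x' : A × C) :
    (M.prod N).liouville (y, y') (x, x')
      = M.liouville (y.1, y'.1) (x.1, x'.1) * N.liouville (y.2, y'.2) (x.2, x'.2) := by
  rw [liouville_apply, liouville_apply, liouville_apply, Finset.sum_mul_sum,
    ← Fintype.sum_prod_type']
  refine Fintype.sum_congr (α := M.Idx × N.Idx) _ _ fun k => ?_
  simp only [prod, Matrix.kroneckerMap_apply, star_mul']
  ring

theorem liouville_pow [DecidableEq B] (N : Channel (A × B) (C × D)) (n : ℕ)
    (y y' : (Fin n → C) × (Fin n → D)) (x x' : (Fin n → A) × (Fin n → B)) :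
    (N.pow n).liouville (y, y') (x, x') = ∏ i, N.liouville
      ((y.1 i, y.2 i), (y'.1 i, y'.2 i)) ((x.1 i, x.2 i), (x'.1 i, x'.2 i)) := by
  simp only [liouville_apply, Fintype.prod_sum]
  refine Finset.sum_congr rfl fun k _ => ?_
  simp only [pow, Matrix.of_apply, star_prod, Finset.prod_mul_distrib]

theorem sum_liouville_diag (N : Channel A B) (a a' : A) :
    ∑ b, N.liouville (b, b) (a, a') = if a = a' then 1 else 0 := by
  have h := congrFun (congrFun N.tracePreserving a') a
  simp only [Matrix.sum_apply, Matrix.mul_apply, Matrix.conjTranspose_apply, Matrix.one_apply]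
    at h
  simp only [liouville_apply, eq_comm (a := a), ← h]
  rw [Finset.sum_comm]
  simp only [mul_comm]

theorem liouville_ofEquiv [DecidableEq B] (e : A ≃ B) :
    (ofEquiv e).liouville
      = (1 : Matrix (B × B) (B × B) ℂ).submatrix _root_.id (e.prodCongr e) := by
  ext ⟨b, b'⟩ ⟨a, a'⟩
  by_cases h : b = e a <;> by_cases h' : b' = e a' <;>
    simp [ofEquiv, liouville_ofIsometry, Matrix.one_apply, h, h']

theorem mul_liouville_ofEquiv [DecidableEq B] {I : Type} (e : A ≃ B) (T : Matrix I (B × B) ℂ)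
    (i : I) (a a' : A) : (T * (ofEquiv e).liouville) i (a, a') = T i (e a, e a') := by
  rw [liouville_ofEquiv]
  exact congrFun₂ (Matrix.mul_submatrix_one (Equiv.refl _) (e.prodCongr e) T) i (a, a')

theorem liouville_comp_ofEquiv [DecidableEq B] (N : Channel B C) (e : A ≃ B) :
    (N.comp (ofEquiv e)).liouville = N.liouville.submatrix _root_.id (e.prodCongr e) := by
  rw [liouville_comp, liouville_ofEquiv]
  exact Matrix.mul_submatrix_one (Equiv.refl _) _ _

theorem liouville_id [DecidableEq B] : (id B).liouville = 1 := by
  rw [id, liouville_ofIsometry, Matrix.map_one _ (map_zero _) (map_one _), Matrix.one_kronecker_one]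

theorem mul_liouville_prod_id [DecidableEq C] {I : Type} (N : Channel A B)
    (T : Matrix I ((B × C) × (B × C)) ℂ) (i : I) (a a' : A) (c c' : C) :
    (T * (N.prod (id C)).liouville) i ((a, c), (a', c'))
      = ∑ b, ∑ b', N.liouville (b, b') (a, a') * T i ((b, c), (b', c')) := by
  simp [Matrix.mul_apply, Fintype.sum_prod_type, liouville_prod, liouville_id, Matrix.one_apply,
    ite_and, mul_comm]

/-! ### Monomial operations -/

/-- The operation maps each matrix unit `|a⟩⟨a'|` to the multiple `g a a'` of the matrix unit
`|f a⟩⟨f a'|`. -/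
def IsMonomial [DecidableEq B] (N : Channel A B) (f : A → B) (g : A → A → ℂ) : Prop :=
  ∀ b b' a a', N.liouville (b, b') (a, a') = if b = f a ∧ b' = f a' then g a a' else 0

theorem IsMonomial.weight_self [DecidableEq B] {N : Channel A B} {f : A → B} {g : A → A → ℂ}
    (hN : N.IsMonomial f g) (a : A) : g a a = 1 := by
  simpa [hN _ _ _ _] using N.sum_liouville_diag a a

theorem IsMonomial.comp_ofEquiv [DecidableEq B] [DecidableEq C] {N : Channel B C} {f : B → C}
    {g : B → B → ℂ} (hN : N.IsMonomial f g) (e : A ≃ B) :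
    (N.comp (ofEquiv e)).IsMonomial (fun a => f (e a)) fun a a' => g (e a) (e a') := by
  intro c c' a a'
  rw [liouville_comp_ofEquiv]
  exact hN _ _ _ _

theorem IsMonomial.pow [DecidableEq B] [DecidableEq C] [DecidableEq D]
    {N : Channel (A × B) (C × D)} {f : A × B → C × D} {g : A × B → A × B → ℂ}
    (hN : N.IsMonomial f g) (n : ℕ) :
    (N.pow n).IsMonomial
      (fun x => (fun i => (f (x.1 i, x.2 i)).1, fun i => (f (x.1 i, x.2 i)).2))
      fun x x' => ∏ i, g (x.1 i, x.2 i) (x'.1 i, x'.2 i) := by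
  intro y y' x x'
  simp only [liouville_pow, hN _ _ _ _]
  rw [Finset.prod_ite_zero]
  congr 1
  simp only [Prod.ext_iff, funext_iff, Finset.mem_univ, true_imp_iff, forall_and]

/-- The operation with Kraus operators `∑ₐ w s a |f s a⟩⟨a|`, indexed by `s`. -/
def ofPartialMaps [DecidableEq B] {S : Type} [Fintype S] (f : S → A → B) (w : S → A → ℂ)
    (h : ∀ a a', (∑ s, if f s a = f s a' then star (w s a) * w s a' else 0)
      = if a = a' then 1 else 0) : Channel A B where
  Idx := S
  kraus s := Matrix.of fun b a => if b = f s a then w s a else 0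
  tracePreserving := by
    ext a a'
    rw [Matrix.one_apply, ← h a a', Matrix.sum_apply]
    refine Finset.sum_congr rfl fun s _ => ?_
    simp only [Matrix.mul_apply, Matrix.conjTranspose_apply, Matrix.of_apply]
    by_cases hs : f s a = f s a' <;> simp [apply_ite, hs, eq_comm]

theorem liouville_ofPartialMaps [DecidableEq B] {S : Type} [Fintype S] (f : S → A → B)
    (w : S → A → ℂ) (h : ∀ a a', (∑ s, if f s a = f s a' then star (w s a) * w s a' else 0)
      = if a = a' then 1 else 0) (p : B × B) (a a' : A) :
    (ofPartialMaps f w h).liouville p (a, a')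
      = ∑ s, if p = (f s a, f s a') then w s a * star (w s a') else 0 := by
  obtain ⟨b, b'⟩ := p
  rw [liouville_apply]
  refine Finset.sum_congr rfl fun s _ => ?_
  by_cases h₁ : b = f s a <;> by_cases h₂ : b' = f s a' <;> simp [ofPartialMaps, h₁, h₂]

theorem sqrt_card_inv_mul_self (K : Type) [Fintype K] :
    (((√(Fintype.card K))⁻¹ : ℝ) : ℂ) * ((√(Fintype.card K))⁻¹ : ℝ) = (Fintype.card K : ℂ)⁻¹ := by
  rw [← Complex.ofReal_mul, ← mul_inv, Real.mul_self_sqrt (by positivity)]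
  simp

/-- A uniformly random key `κ` is drawn and the isometry `|a⟩ ↦ φ κ a |f κ a⟩` is applied. -/
def randomMonomial [DecidableEq B] {K : Type} [Fintype K] [Nonempty K] (f : K → A → B)
    (φ : K → A → ℂ) (hf : ∀ κ, Function.Injective (f κ)) (hφ : ∀ κ a, star (φ κ a) * φ κ a = 1) :
    Channel A B :=
  ofPartialMaps f (fun κ a => ((√(Fintype.card K))⁻¹ : ℝ) * φ κ a) fun a a' => by
    by_cases h : a = a'
    · subst h
      simp_rw [if_true, star_mul', Complex.star_def, Complex.conj_ofReal, mul_mul_mul_comm,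
        sqrt_card_inv_mul_self, ← Complex.star_def, hφ]
      simp
    · simp [h, fun κ => (hf κ).ne h]

theorem mul_liouville_randomMonomial [DecidableEq B] {K I : Type} [Fintype K] [Nonempty K]
    (f : K → A → B) (φ : K → A → ℂ) (hf : ∀ κ, Function.Injective (f κ))
    (hφ : ∀ κ a, star (φ κ a) * φ κ a = 1) (T : Matrix I (B × B) ℂ) (i : I) (a a' : A) :
    (T * (randomMonomial f φ hf hφ).liouville) i (a, a')
      = (Fintype.card K : ℂ)⁻¹ * ∑ κ, φ κ a * star (φ κ a') * T i (f κ a, f κ a') := by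
  rw [Matrix.mul_apply]
  simp_rw [randomMonomial, liouville_ofPartialMaps, Finset.mul_sum]
  rw [Finset.sum_comm]
  refine Finset.sum_congr rfl fun κ _ => ?_
  simp only [mul_ite, mul_zero, Finset.sum_ite_eq', Finset.mem_univ, if_true,
    ← sqrt_card_inv_mul_self, star_mul', Complex.star_def, Complex.conj_ofReal]
  ring

/-- The operation that applies `|a⟩ ↦ φ a |f a⟩|d a⟩` and discards the second system. -/
def discarding [DecidableEq B] {S : Type} [Fintype S] [DecidableEq S] (f : A → B) (d : A → S)
    (φ : A → ℂ) (hfd : Function.Injective fun a => (f a, d a))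
    (hφ : ∀ a, star (φ a) * φ a = 1) : Channel A B :=
  ofPartialMaps (fun _ : S => f) (fun s a => if s = d a then φ a else 0) fun a a' => by
    have h (s : S) : (if f a = f a' then star (if s = d a then φ a else 0)
        * (if s = d a' then φ a' else 0) else 0)
        = if s = d a then (if (f a, d a) = (f a', d a') then star (φ a) * φ a' else 0) else 0 := by
      by_cases h₁ : f a = f a' <;> by_cases h₂ : s = d a <;> simp [h₁, h₂]
    simp only [h, Finset.sum_ite_eq', Finset.mem_univ, if_true, hfd.eq_iff (a := a)]
    by_cases ha : a = a'
    · simp only [ha, if_true, hφ]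
    · simp [ha]

theorem liouville_discarding [DecidableEq B] {S : Type} [Fintype S] [DecidableEq S] (f : A → B)
    (d : A → S) (φ : A → ℂ) (hfd : Function.Injective fun a => (f a, d a))
    (hφ : ∀ a, star (φ a) * φ a = 1) (b b' : B) (a a' : A) :
    (discarding f d φ hfd hφ).liouville (b, b') (a, a')
      = if b = f a ∧ b' = f a' ∧ d a = d a' then φ a * star (φ a') else 0 := by
  have h (s : S) : (if (b, b') = (f a, f a') then (if s = d a then φ a else 0)
      * star (if s = d a' then φ a' else 0) else 0)
      = if s = d a then (if b = f a ∧ b' = f a' ∧ d a = d a' then φ a * star (φ a') else 0)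
        else 0 := by
    rcases eq_or_ne s (d a) with rfl | hs
    · by_cases h₁ : b = f a <;> by_cases h₂ : b' = f a' <;> by_cases h₃ : d a = d a' <;>
        simp [h₁, h₂, h₃]
    · simp [hs]
  simp only [discarding, liouville_ofPartialMaps, h, Finset.sum_ite_eq', Finset.mem_univ, if_true]

end Channel

/-! ### Parallel use of a resource -/

/-- The matrix of a relabelling `e` of the basis. -/
def permMatrix {A B : Type} [DecidableEq B] (e : A ≃ B) : Matrix B A ℂ :=
  Matrix.of fun b a => if b = e a then 1 else 0

theorem permMatrix_isometry {A B : Type} [DecidableEq A] [Fintype B] [DecidableEq B] (e : A ≃ B) :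
    (permMatrix e)ᴴ * permMatrix e = 1 := by
  ext a a'
  simp [permMatrix, Matrix.mul_apply, Matrix.one_apply, eq_comm]

/-- The relabelling that puts one more pair of systems in front of a pair of tuples. -/
def consPairEquiv (X Y : Type) (j : ℕ) :
    (X × Y) × ((Fin j → X) × (Fin j → Y)) ≃ (Fin (j + 1) → X) × (Fin (j + 1) → Y) :=
  (Equiv.prodProdProdComm _ _ _ _).trans
    ((Fin.consEquiv fun _ => X).prodCongr (Fin.consEquiv fun _ => Y))

/-- The relabelling that puts one more system in front of a tuple. -/
def consEquiv (X Z : Type) (j : ℕ) : (Fin j → X) × (X × Z) ≃ (Fin (j + 1) → X) × Z where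
  toFun t := (Fin.cons t.2.1 t.1, t.2.2)
  invFun s := (Fin.tail s.1, (s.1 0, s.2))
  left_inv _ := by simp
  right_inv _ := by simp

/-- The relabelling that separates the first pair of systems from everything else. -/
def firstEquiv (X Y Z : Type) (j : ℕ) : ((Fin (j + 1) → X) × (Fin (j + 1) → Y)) × Z
    ≃ (X × Y) × (((Fin j → X) × (Fin j → Y)) × Z) :=
  ((consPairEquiv X Y j).symm.prodCongr (Equiv.refl Z)).trans (Equiv.prodAssoc _ _ _)

theorem firstEquiv_apply {X Y Z : Type} {j : ℕ}
    (s : ((Fin (j + 1) → X) × (Fin (j + 1) → Y)) × Z) :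
    firstEquiv X Y Z j s
      = ((s.1.1 0, s.1.2 0), ((Fin.tail s.1.1, Fin.tail s.1.2), s.2)) := rfl

/-- The exchange of the first two of three systems. -/
def leftCommEquiv (X Y Z : Type) : X × (Y × Z) ≃ Y × (X × Z) where
  toFun t := (t.2.1, (t.1, t.2.2))
  invFun t := (t.2.1, (t.1, t.2.2))

namespace Steps

variable {OA OB : Type} [Fintype OA] [DecidableEq OA] [Fintype OB] [DecidableEq OB]
  {M Keep W : Type} [Fintype M] [DecidableEq M] [Fintype Keep] [DecidableEq Keep]
  [Fintype W] [DecidableEq W] {I : Type}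

theorem mul_liouville_encodeStep {r : FiniteResource} (e : M ≃ (r.Rel × r.Abs) × Keep)
    (T : Matrix I (((r.Rel × r.Abs) × (Keep × W)) × ((r.Rel × r.Abs) × (Keep × W))) ℂ) (i : I)
    (s s' : M × W) :
    (T * (encodeStep (W := W) (permMatrix e) (permMatrix_isometry e)).liouville) i (s, s')
      = T i (((e s.1).1, ((e s.1).2, s.2)), ((e s'.1).1, ((e s'.1).2, s'.2))) := by
  have h : Channel.ofIsometry (permMatrix e) (permMatrix_isometry e) = Channel.ofEquiv e := rfl
  obtain ⟨m, w⟩ := s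
  obtain ⟨m', w'⟩ := s'
  rw [encodeStep, h, Channel.liouville_comp, ← Matrix.mul_assoc, Channel.mul_liouville_prod_id]
  simp only [Channel.mul_liouville_ofEquiv]
  simp [Channel.liouville_ofEquiv, Matrix.one_apply, ite_and]

theorem mul_liouville_useStep (r : FiniteResource)
    (T : Matrix I (((r.OutA × Keep) × (r.OutB × W)) × ((r.OutA × Keep) × (r.OutB × W))) ℂ) (i : I)
    (x x' : r.Rel × r.Abs) (z z' : Keep × W) :
    (T * (useStep r Keep W).liouville) i ((x, z), (x', z'))
      = ∑ o, ∑ o', r.op.liouville (o, o') (x, x')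
        * T i (((o.1, z.1), (o.2, z.2)), ((o'.1, z'.1), (o'.2, z'.2))) := by
  rw [useStep, Channel.liouville_comp, ← Matrix.mul_assoc, Channel.mul_liouville_prod_id]
  simp only [Channel.mul_liouville_ofEquiv]
  rfl

theorem liouville_channel_step {r : FiniteResource} {rs : List FiniteResource}
    (e : M ≃ (r.Rel × r.Abs) × Keep) (next : Steps OA OB rs (r.OutA × Keep) (r.OutB × W))
    (y : (OA × OB) × (OA × OB)) (s s' : M × W) :
    (step Keep (permMatrix e) (permMatrix_isometry e) next).channel.liouville y (s, s')
      = ∑ o, ∑ o', r.op.liouville (o, o') ((e s.1).1, (e s'.1).1)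
        * next.channel.liouville y
          (((o.1, (e s.1).2), (o.2, s.2)), ((o'.1, (e s'.1).2), (o'.2, s'.2))) := by
  rw [channel, Channel.liouville_comp, Channel.liouville_comp, ← Matrix.mul_assoc,
    mul_liouville_encodeStep, mul_liouville_useStep]

/-- All `j` copies of `r` are used, in a row, on `j` input systems that Alice holds from the
beginning together with a further system `Keep`; the outputs are processed at the end. -/
def parallel (r : FiniteResource) : (j : ℕ) → {M Keep W : Type} →
    [Fintype M] → [DecidableEq M] → [Fintype Keep] → [DecidableEq Keep] →
    [Fintype W] → [DecidableEq W] →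
    (M ≃ ((Fin j → r.Rel) × (Fin j → r.Abs)) × Keep) →
    Channel ((Fin j → r.OutA) × Keep) OA → Channel ((Fin j → r.OutB) × W) OB →
    Steps OA OB (List.replicate j r) M W
  | 0, _, Keep, W, _, _, _, _, _, _, e, encode, decode =>
      finish (encode.comp (Channel.ofEquiv (e.trans
          (((Equiv.prodUnique _ _).trans (Equiv.ofUnique _ _)).prodCongr (Equiv.refl Keep)))))
        (decode.comp (Channel.ofEquiv (Equiv.uniqueProd W (Fin 0 → r.OutB)).symm))
  | j + 1, _, Keep, W, _, _, _, _, _, _, e, encode, decode =>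
      step (((Fin j → r.Rel) × (Fin j → r.Abs)) × Keep)
        (permMatrix (e.trans (firstEquiv r.Rel r.Abs Keep j))) (permMatrix_isometry _)
        (parallel r j (leftCommEquiv _ _ _)
          (encode.comp (Channel.ofEquiv (consEquiv r.OutA Keep j)))
          (decode.comp (Channel.ofEquiv (consEquiv r.OutB W j))))

theorem liouville_channel_parallel (r : FiniteResource) (j : ℕ)
    (e : M ≃ ((Fin j → r.Rel) × (Fin j → r.Abs)) × Keep)
    (encode : Channel ((Fin j → r.OutA) × Keep) OA) (decode : Channel ((Fin j → r.OutB) × W) OB)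
    (y y' : OA × OB) (s s' : M × W) :
    (parallel r j e encode decode).channel.liouville (y, y') (s, s')
      = ∑ o, ∑ o', (r.op.pow j).liouville (o, o') ((e s.1).1, (e s'.1).1)
        * (encode.liouville (y.1, y'.1) ((o.1, (e s.1).2), (o'.1, (e s'.1).2))
          * decode.liouville (y.2, y'.2) ((o.2, s.2), (o'.2, s'.2))) := by
  induction j generalizing M Keep W with
  | zero =>
    simp only [Channel.liouville_pow, Fintype.sum_prod_type, Fintype.sum_unique,
      Finset.univ_eq_empty, Finset.prod_empty, one_mul, parallel, channel,
      Channel.liouville_prod, Channel.liouville_comp_ofEquiv]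
    rfl
  | succ j ih =>
    rw [parallel, liouville_channel_step]
    simp only [ih, Finset.mul_sum, ← (consPairEquiv r.OutA r.OutB j).sum_comp,
      Fintype.sum_prod_type (α₁ := _ × _)]
    refine Finset.sum_congr rfl fun p _ => ?_
    rw [Finset.sum_comm]
    refine Finset.sum_congr rfl fun q _ => Finset.sum_congr rfl fun p' _ =>
      Finset.sum_congr rfl fun q' _ => ?_
    simp only [Channel.liouville_pow, Fin.prod_univ_succ, Channel.liouville_comp_ofEquiv]
    rw [← mul_assoc]
    rfl

end Steps

/-! ### Validity of the parallel use -/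

open Classical in
/-- The Liouville matrix of the partial trace that keeps the part `f s` of each basis label `s`
and discards the part `d s`. -/
def partialTrace {S R Y : Type} (f : S → R) (d : S → Y) : Matrix (R × R) (S × S) ℂ :=
  Matrix.of fun c s => if f s.1 = c.1 ∧ f s.2 = c.2 ∧ d s.1 = d s.2 then 1 else 0

open Classical in
theorem partialTrace_congr {S R Y Z : Type} (f : S → R) {d : S → Y} {d' : S → Z}
    (h : ∀ s s', d s = d s' ↔ d' s = d' s') : partialTrace f d = partialTrace f d' := by
  ext c s
  exact if_congr (and_congr_right' (and_congr_right' (h s.1 s.2))) rfl rfl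

theorem uncurry_traceSnd_traceSnd {R Q Y : Type} [Fintype R] [Fintype Q] [Fintype Y]
    (σ : Matrix ((R × Q) × Y) ((R × Q) × Y) ℂ) :
    Function.uncurry (traceSnd (traceSnd σ))
      = partialTrace (fun s => s.1.1) (fun s : (R × Q) × Y => (s.1.2, s.2))
        *ᵥ Function.uncurry σ := by
  classical
  ext ⟨c, c'⟩
  simp [Function.uncurry, traceSnd, partialTrace, Matrix.mulVec, dotProduct,
    Fintype.sum_prod_type, ite_and]

theorem traceNorm_zero {A : Type} [Fintype A] [DecidableEq A] :
    traceNorm (0 : Matrix A A ℂ) = 0 := by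
  have h : (Matrix.isHermitian_conjTranspose_mul_self (0 : Matrix A A ℂ)).eigenvalues = 0 :=
    (Matrix.IsHermitian.eigenvalues_eq_zero_iff _).mpr (by simp)
  rw [traceNorm, h]
  simp

namespace Steps

section

/-- The Liouville matrix of the restriction to the test system of the `i`-th of `j` copies of `r`,
when a basis label `s` consists of the inputs `x s` of these copies and the rest `d s`. -/
def testMarginal (r : FiniteResource) {j : ℕ} {S Y : Type}
    (x : S → (Fin j → r.Rel) × (Fin j → r.Abs)) (d : S → Y) (i : Fin j) :
    Matrix (r.Rel × r.Rel) (S × S) ℂ :=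
  partialTrace (fun s => (x s).1 i) fun s => ((fun q : {q // q ≠ i} => (x s).1 q), (x s).2, d s)

variable {M Keep W : Type}

theorem testMarginal_zero (r : FiniteResource) {j : ℕ}
    (e : M ≃ ((Fin (j + 1) → r.Rel) × (Fin (j + 1) → r.Abs)) × Keep) :
    testMarginal r (fun s : M × W => (e s.1).1) (fun s => ((e s.1).2, s.2)) 0 = partialTrace
      (fun s => (firstEquiv r.Rel r.Abs Keep j (e s.1)).1.1)
      fun s => ((firstEquiv r.Rel r.Abs Keep j (e s.1)).1.2,
        (firstEquiv r.Rel r.Abs Keep j (e s.1)).2, s.2) := by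
  refine partialTrace_congr _ fun s s' => ?_
  simp only [firstEquiv_apply, Prod.ext_iff, funext_iff, Subtype.forall, Fin.forall_fin_succ,
    Fin.tail, ne_eq, Fin.succ_ne_zero, not_true_eq_false, not_false_eq_true, forall_const,
    IsEmpty.forall_iff, true_and]
  tauto

theorem testMarginal_succ (r : FiniteResource) {j : ℕ}
    (e : M ≃ ((Fin (j + 1) → r.Rel) × (Fin (j + 1) → r.Abs)) × Keep) (i : Fin j) :
    testMarginal r (fun s : M × W => (e s.1).1) (fun s => ((e s.1).2, s.2)) i.succ = partialTrace
      (fun s => (firstEquiv r.Rel r.Abs Keep j (e s.1)).2.1.1 i)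
      fun s => ((firstEquiv r.Rel r.Abs Keep j (e s.1)).1,
        ((fun q : {q // q ≠ i} => (firstEquiv r.Rel r.Abs Keep j (e s.1)).2.1.1 q),
          (firstEquiv r.Rel r.Abs Keep j (e s.1)).2.1.2,
          (firstEquiv r.Rel r.Abs Keep j (e s.1)).2.2, s.2)) := by
  refine partialTrace_congr _ fun s s' => ?_
  simp only [firstEquiv_apply, Prod.ext_iff, funext_iff, Subtype.forall, Fin.forall_fin_succ,
    Fin.tail, ne_eq, (Fin.succ_ne_zero i).symm, not_false_eq_true, forall_const, Fin.succ_inj]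
  tauto

end

variable {OA OB : Type} [Fintype OA] [DecidableEq OA] [Fintype OB] [DecidableEq OB]
  {M Keep W : Type} [Fintype M] [DecidableEq M] [Fintype Keep] [DecidableEq Keep]
  [Fintype W] [DecidableEq W]

theorem partialTrace_mul_encodeStep {r : FiniteResource} (e : M ≃ (r.Rel × r.Abs) × Keep)
    {R Y : Type} (f : (r.Rel × r.Abs) × (Keep × W) → R) (d : (r.Rel × r.Abs) × (Keep × W) → Y) :
    partialTrace f d * (encodeStep (W := W) (permMatrix e) (permMatrix_isometry e)).liouville
      = partialTrace (fun s => f ((e s.1).1, ((e s.1).2, s.2)))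
        fun s => d ((e s.1).1, ((e s.1).2, s.2)) := by
  ext c ⟨s, s'⟩
  exact mul_liouville_encodeStep e _ c s s'

theorem partialTrace_mul_useStep (r : FiniteResource) {R Y : Type} (f : Keep × W → R)
    (d : Keep × W → Y) :
    partialTrace (fun t : (r.OutA × Keep) × (r.OutB × W) => f (t.1.2, t.2.2))
        (fun t => ((t.1.1, t.2.1), d (t.1.2, t.2.2))) * (useStep r Keep W).liouville
      = partialTrace (fun t => f t.2) fun t => (t.1, d t.2) := by
  ext c ⟨⟨x, z⟩, ⟨x', z'⟩⟩
  have h := r.op.sum_liouville_diag x x'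
  rw [mul_liouville_useStep]
  simp only [partialTrace, Matrix.of_apply, Prod.mk.eta]
  by_cases hz : f z = c.1 ∧ f z' = c.2 ∧ d z = d z'
  · simpa [hz] using h
  · rw [if_neg fun hc => hz ⟨hc.1, hc.2.1, (Prod.mk.inj hc.2.2).2⟩]
    refine Finset.sum_eq_zero fun o _ => Finset.sum_eq_zero fun o' _ => ?_
    rw [if_neg fun hc => hz ⟨hc.1, hc.2.1, (Prod.mk.inj hc.2.2).2⟩, mul_zero]

theorem partialTrace_mulVec_useStep_encodeStep {r : FiniteResource}
    (e : M ≃ (r.Rel × r.Abs) × Keep) {R Y : Type} (f : Keep × W → R) (d : Keep × W → Y)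
    (σ : Matrix (M × W) (M × W) ℂ) :
    partialTrace (fun t : (r.OutA × Keep) × (r.OutB × W) => f (t.1.2, t.2.2))
        (fun t => ((t.1.1, t.2.1), d (t.1.2, t.2.2)))
        *ᵥ Function.uncurry ((useStep r Keep W).apply
          ((encodeStep (permMatrix e) (permMatrix_isometry e)).apply σ))
      = partialTrace (fun s => f ((e s.1).2, s.2)) (fun s => ((e s.1).1, d ((e s.1).2, s.2)))
        *ᵥ Function.uncurry σ := by
  rw [Channel.uncurry_apply, Channel.uncurry_apply, Matrix.mulVec_mulVec,
    partialTrace_mul_useStep, Matrix.mulVec_mulVec, partialTrace_mul_encodeStep]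

theorem valid_step {r : FiniteResource} {rs : List FiniteResource}
    (e : M ≃ (r.Rel × r.Abs) × Keep) (next : Steps OA OB rs (r.OutA × Keep) (r.OutB × W))
    {σ : Matrix (M × W) (M × W) ℂ}
    (htest : partialTrace (fun s => (e s.1).1.1) (fun s => ((e s.1).1.2, (e s.1).2, s.2))
      *ᵥ Function.uncurry σ = Function.uncurry r.test.mat)
    (hnext : next.Valid 0 ((useStep r Keep W).apply
      ((encodeStep (permMatrix e) (permMatrix_isometry e)).apply σ))) :
    (step Keep (permMatrix e) (permMatrix_isometry e) next).Valid 0 σ := by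
  have h : traceSnd (traceSnd ((encodeStep (W := W) (permMatrix e)
      (permMatrix_isometry e)).apply σ)) = r.test.mat := by
    refine Function.uncurry_injective ?_
    rw [uncurry_traceSnd_traceSnd, Channel.uncurry_apply, Matrix.mulVec_mulVec,
      partialTrace_mul_encodeStep, htest]
  exact ⟨by rw [h, sub_self, traceNorm_zero], hnext⟩

theorem valid_parallel (r : FiniteResource) {j : ℕ}
    (e : M ≃ ((Fin j → r.Rel) × (Fin j → r.Abs)) × Keep)
    (encode : Channel ((Fin j → r.OutA) × Keep) OA) (decode : Channel ((Fin j → r.OutB) × W) OB)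
    {σ : Matrix (M × W) (M × W) ℂ}
    (h : ∀ i, testMarginal r (fun s => (e s.1).1) (fun s => ((e s.1).2, s.2)) i
      *ᵥ Function.uncurry σ = Function.uncurry r.test.mat) :
    (parallel r j e encode decode).Valid 0 σ := by
  induction j generalizing M Keep W with
  | zero => trivial
  | succ j ih =>
    refine valid_step _ _ ?_ (ih _ _ _ fun i => ?_)
    · rw [← h 0, testMarginal_zero]
      rfl
    · rw [← h i.succ, testMarginal_succ]
      refine (congrArg (· *ᵥ _) (partialTrace_congr _ fun s s' => ?_)).trans
        (partialTrace_mulVec_useStep_encodeStep (e.trans (firstEquiv r.Rel r.Abs Keep j))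
          (fun t => t.1.1.1 i)
          (fun t => ((fun q : {q // q ≠ i} => t.1.1.1 q), t.1.1.2, t.1.2, t.2)) σ)
      simp only [Prod.ext_iff]
      tauto

end Steps

/-! ### Exact simulation -/

theorem DepthResource.times_singleton (k : ℕ) (r : FiniteResource) :
    DepthResource.times k [r] = List.replicate k r := by
  simp [DepthResource.times]

namespace Protocol

theorem mul_liouville_prodPUnit_symm_comp {A B I : Type} [Fintype A] [DecidableEq A] [Fintype B]
    [DecidableEq B] (N : Channel A B) (T : Matrix I ((B × Unit) × (B × Unit)) ℂ) :
    T * ((Channel.ofEquiv (Equiv.prodPUnit B).symm).comp N).liouville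
      = T.submatrix _root_.id (fun s => ((s.1, ()), (s.2, ()))) * N.liouville := by
  rw [Channel.liouville_comp, ← Matrix.mul_assoc]
  congr 1
  ext i ⟨s, s'⟩
  exact Channel.mul_liouville_ofEquiv _ T i s s'

variable {r : FiniteResource} {k : ℕ} {In OA OB Keep : Type} [Fintype In] [DecidableEq In]
  [Fintype OA] [DecidableEq OA] [Fintype OB] [DecidableEq OB] [Fintype Keep] [DecidableEq Keep]

/-- The protocol in which Alice prepares the inputs of all `k` copies of `r` at once. -/
def parallel (init : Channel In (((Fin k → r.Rel) × (Fin k → r.Abs)) × Keep))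
    (encode : Channel ((Fin k → r.OutA) × Keep) OA)
    (decode : Channel ((Fin k → r.OutB) × Unit) OB) :
    Protocol (DepthResource.times k [r]) In OA OB where
  order := List.replicate k r
  perm := by rw [DepthResource.times_singleton]
  Mem := ((Fin k → r.Rel) × (Fin k → r.Abs)) × Keep
  init := init
  steps := Steps.parallel r k (Equiv.refl _) encode decode

variable (init : Channel In (((Fin k → r.Rel) × (Fin k → r.Abs)) × Keep))
  (encode : Channel ((Fin k → r.OutA) × Keep) OA) (decode : Channel ((Fin k → r.OutB) × Unit) OB)

/-- The Liouville matrix of the part of `Protocol.parallel` that follows the initial operation. -/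
def transmit : Matrix ((OA × OB) × (OA × OB))
    ((((Fin k → r.Rel) × (Fin k → r.Abs)) × Keep) ×
      (((Fin k → r.Rel) × (Fin k → r.Abs)) × Keep)) ℂ :=
  Matrix.of fun y s => ∑ o, ∑ o', (r.op.pow k).liouville (o, o') (s.1.1, s.2.1)
    * (encode.liouville (y.1.1, y.2.1) ((o.1, s.1.2), (o'.1, s.2.2))
      * decode.liouville (y.1.2, y.2.2) ((o.2, ()), (o'.2, ())))

theorem liouville_channel_parallel :
    (parallel init encode decode).channel.liouville
      = transmit encode decode * init.liouville := by
  rw [channel, start, Channel.liouville_comp, mul_liouville_prodPUnit_symm_comp]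
  congr 1
  ext ⟨y, y'⟩ ⟨s, s'⟩
  exact Steps.liouville_channel_parallel r k (Equiv.refl _) encode decode y y' (s, ()) (s', ())

theorem valid_parallel {ρ : Matrix In In ℂ} (hρ : ρ.trace = 1)
    (h : ∀ i : Fin k, Steps.testMarginal r
      (S := ((Fin k → r.Rel) × (Fin k → r.Abs)) × Keep) (Y := Keep) Prod.fst Prod.snd i
        * init.liouville = Matrix.of fun c a => if a.1 = a.2 then r.test.mat c.1 c.2 else 0) :
    (parallel init encode decode).steps.Valid 0
      ((parallel init encode decode).start.apply ρ) := by
  change (Steps.parallel r k (Equiv.refl _) encode decode).Valid 0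
    (((Channel.ofEquiv (Equiv.prodPUnit (((Fin k → r.Rel) × (Fin k → r.Abs)) × Keep)).symm).comp
      init).apply ρ)
  refine Steps.valid_parallel r _ _ _ fun i => ?_
  have hstart : Steps.testMarginal r
      (fun s : (((Fin k → r.Rel) × (Fin k → r.Abs)) × Keep) × Unit => s.1.1)
      (Y := Keep × Unit) (fun s => (s.1.2, s.2)) i
      * ((Channel.ofEquiv (Equiv.prodPUnit _).symm).comp init).liouville
      = Steps.testMarginal r (Y := Keep) Prod.fst Prod.snd i * init.liouville := by
    refine (mul_liouville_prodPUnit_symm_comp init _).trans (congrArg (· * _) ?_)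
    ext c ⟨s, s'⟩
    simp [Steps.testMarginal, partialTrace]
  have htrace : ∑ a, ρ a a = 1 := hρ
  rw [Channel.uncurry_apply, Matrix.mulVec_mulVec]
  refine (congrArg (· *ᵥ Function.uncurry ρ) (hstart.trans (h i))).trans ?_
  ext c
  simp [Matrix.mulVec, dotProduct, Fintype.sum_prod_type, Function.uncurry, ite_mul,
    ← Finset.mul_sum, htrace]

end Protocol

/-- The collection `α` simulates the finite resource `t` without error: some protocol has exactly
the channel of `t`, and all its inputs agree exactly with the test states. -/
def Simulates (α : DepthResource) (t : FiniteResource) : Prop :=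
  ∃ P : Protocol α (t.Rel × t.Abs) t.OutA t.OutB,
    (∀ ρ, traceSnd ρ = t.test.mat → P.steps.Valid 0 (P.start.apply ρ)) ∧
      P.channel.liouville = t.op.liouville

theorem Simulates.of_parallel {r t : FiniteResource} {k : ℕ} {Keep : Type} [Fintype Keep]
    [DecidableEq Keep]
    (init : Channel (t.Rel × t.Abs) (((Fin k → r.Rel) × (Fin k → r.Abs)) × Keep))
    (encode : Channel ((Fin k → r.OutA) × Keep) t.OutA)
    (decode : Channel ((Fin k → r.OutB) × Unit) t.OutB)
    (hvalid : ∀ i : Fin k, Steps.testMarginal r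
      (S := ((Fin k → r.Rel) × (Fin k → r.Abs)) × Keep) (Y := Keep) Prod.fst Prod.snd i
        * init.liouville = Matrix.of fun c a => if a.1 = a.2 then r.test.mat c.1 c.2 else 0)
    (hop : (Protocol.parallel init encode decode).channel.liouville = t.op.liouville) :
    Simulates (DepthResource.times k [r]) t := by
  refine ⟨.parallel init encode decode, fun ρ hρ => ?_, hop⟩
  refine Protocol.valid_parallel init encode decode ?_ hvalid
  have htrace : (traceSnd ρ).trace = ρ.trace := by
    simp [Matrix.trace, traceSnd, Fintype.sum_prod_type]
  rw [← htrace, hρ, t.test.trace_eq_one]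

namespace Steps

variable {OA OB : Type} [Fintype OA] [DecidableEq OA] [Fintype OB] [DecidableEq OB]

theorem Valid.mono {η ε : ℝ} (h : η ≤ ε) : ∀ {rs : List FiniteResource} {M W : Type}
    [Fintype M] [DecidableEq M] [Fintype W] [DecidableEq W] {S : Steps OA OB rs M W}
    {σ : Matrix (M × W) (M × W) ℂ}, S.Valid η σ → S.Valid ε σ
  | _, _, _, _, _, _, _, finish _ _, _, _ => trivial
  | _, _, _, _, _, _, _, step _ _ _ _, _, hS => ⟨hS.1.trans h, hS.2.mono h⟩

end Steps

theorem relDist_eq_zero {R' A' B : Type} [Fintype R'] [DecidableEq R'] [Fintype A']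
    [DecidableEq A'] [Fintype B] [DecidableEq B] {M N : Channel (R' × A') B}
    (h : M.liouville = N.liouville) (ω : State R') : relDist M N ω = 0 := by
  simp only [relDist, ENNReal.iSup_eq_zero]
  intro R _ _ ξ _
  have hR : ((Channel.id R).prod M).liouville = ((Channel.id R).prod N).liouville := by
    ext ⟨y, y'⟩ ⟨x, x'⟩
    rw [Channel.liouville_prod, Channel.liouville_prod, h]
  rw [Channel.apply_congr hR, sub_self, traceNorm_zero, ENNReal.ofReal_zero]

theorem ResourceSequence.ge_of_simulates {α β : ResourceSequence}
    (h : ∀ δ : ℝ, 0 < δ → ∃ k : ℕ, 0 < k ∧ ∃ n₀ : ℕ, ∀ n : ℕ, n₀ ≤ n →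
      Simulates (DepthResource.times k (α (n / k))) (DepthResource.standard (β ⌊(1 - δ) * n⌋₊))) :
    α.Ge β := by
  intro δ hδ
  obtain ⟨k, hk, n₀, hsim⟩ := h δ hδ
  refine ⟨k, hk, fun ε hε => ⟨n₀, fun n hn => ?_⟩⟩
  obtain ⟨P, hvalid, hop⟩ := hsim n hn
  exact ⟨P, fun R _ ξ hξ => (hvalid _ hξ).mono hε.le, by rw [relDist_eq_zero hop]; exact bot_le⟩

/-- `K` is the set of random keys that Alice draws from, `Keep` the memory in which she retains what
`encode` needs of the key. -/
theorem Simulates.of_isMonomial {r t : FiniteResource} {k : ℕ} {K Keep : Type} [Fintype K]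
    [Nonempty K] [Fintype Keep] [DecidableEq Keep]
    {fr : r.Rel × r.Abs → r.OutA × r.OutB} {gr : r.Rel × r.Abs → r.Rel × r.Abs → ℂ}
    (hr : r.op.IsMonomial fr gr)
    {ft : t.Rel × t.Abs → t.OutA × t.OutB} {gt : t.Rel × t.Abs → t.Rel × t.Abs → ℂ}
    (ht : t.op.IsMonomial ft gt)
    {blocks : K → t.Rel × t.Abs → ((Fin k → r.Rel) × (Fin k → r.Abs)) × Keep}
    {φ : K → t.Rel × t.Abs → ℂ} (hblocks : ∀ κ, Function.Injective (blocks κ))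
    (hφ : ∀ κ a, star (φ κ a) * φ κ a = 1)
    (encode : Channel ((Fin k → r.OutA) × Keep) t.OutA)
    (decode : Channel ((Fin k → r.OutB) × Unit) t.OutB)
    (hvalid : ∀ i c a a', (Fintype.card K : ℂ)⁻¹ * ∑ κ, φ κ a * star (φ κ a')
        * Steps.testMarginal r (S := ((Fin k → r.Rel) × (Fin k → r.Abs)) × Keep) (Y := Keep)
          Prod.fst Prod.snd i c (blocks κ a, blocks κ a')
      = if a = a' then r.test.mat c.1 c.2 else 0)
    (hweight : ∀ κ a a', ∏ q, gr ((blocks κ a).1.1 q, (blocks κ a).1.2 q)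
      ((blocks κ a').1.1 q, (blocks κ a').1.2 q) = gt a a')
    (hencode : ∀ κ a a' y y', encode.liouville (y, y')
        ((fun q => (fr ((blocks κ a).1.1 q, (blocks κ a).1.2 q)).1, (blocks κ a).2),
          (fun q => (fr ((blocks κ a').1.1 q, (blocks κ a').1.2 q)).1, (blocks κ a').2))
      = if y = (ft a).1 ∧ y' = (ft a').1 then 1 else 0)
    (hdecode : ∀ κ a a' y y', decode.liouville (y, y')
        ((fun q => (fr ((blocks κ a).1.1 q, (blocks κ a).1.2 q)).2, ()),
          (fun q => (fr ((blocks κ a').1.1 q, (blocks κ a').1.2 q)).2, ()))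
      = if y = (ft a).2 ∧ y' = (ft a').2 then star (φ κ a) * φ κ a' else 0) :
    Simulates (DepthResource.times k [r]) t := by
  refine .of_parallel (Channel.randomMonomial blocks φ hblocks hφ) encode decode (fun i => ?_) ?_
  · ext c ⟨a, a'⟩
    rw [Channel.mul_liouville_randomMonomial, hvalid, Matrix.of_apply]
  rw [Protocol.liouville_channel_parallel]
  ext ⟨y, y'⟩ ⟨a, a'⟩
  rw [Channel.mul_liouville_randomMonomial, ht]
  have hphase (κ : K) : φ κ a * star (φ κ a') * (star (φ κ a) * φ κ a') = 1 := by
    rw [← mul_one (1 : ℂ), ← congrArg₂ (· * ·) (hφ κ a) (hφ κ a')]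
    ring
  have hkey (κ : K) : φ κ a * star (φ κ a')
      * Protocol.transmit encode decode (y, y') (blocks κ a, blocks κ a')
      = if y = ft a ∧ y' = ft a' then gt a a' else 0 := by
    simp only [Protocol.transmit, Matrix.of_apply, hr.pow k _ _ _ _, ite_and, ite_mul, zero_mul,
      Finset.sum_ite_eq', Finset.sum_ite_irrel, Finset.sum_const_zero,
      Finset.mem_univ, if_true, hencode, hdecode, hweight]
    simp only [Prod.ext_iff (x := y), Prod.ext_iff (x := y')]
    by_cases h₁ : y.1 = (ft a).1 <;> by_cases h₂ : y.2 = (ft a).2 <;>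
      by_cases h₃ : y'.1 = (ft a').1 <;> by_cases h₄ : y'.2 = (ft a').2 <;>
      simp only [h₁, h₂, h₃, h₄, and_self, and_true, and_false, if_true, if_false, mul_zero,
        one_mul]
    linear_combination gt a a' * hphase κ
  simp_rw [hkey]
  simp

/-! ### Padding -/

section

variable {I J X Y : Type}

/-- The word `a` placed along `e` and filled up with the letter `x₀`. -/
def pad (e : I ↪ J) (x₀ : X) (a : I → X) : J → X :=
  Function.extend e a fun _ => x₀

theorem pad_apply (e : I ↪ J) (x₀ : X) (a : I → X) (i : I) : pad e x₀ a (e i) = a i :=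
  e.injective.extend_apply _ _ i

theorem pad_of_notMem_range (e : I ↪ J) (x₀ : X) (a : I → X) {q : J} (hq : q ∉ Set.range e) :
    pad e x₀ a q = x₀ :=
  Function.extend_apply' _ _ q hq

theorem pad_injective (e : I ↪ J) (x₀ : X) : Function.Injective (pad e x₀) := fun a a' h =>
  funext fun i => by rw [← pad_apply e x₀ a, h, pad_apply]

theorem prod_pad {M : Type} [CommMonoid M] [Fintype I] [Fintype J] (e : I ↪ J) {x₀ : X}
    {g : X → X → M} (hg : g x₀ x₀ = 1) (a a' : I → X) :
    ∏ q, g (pad e x₀ a q) (pad e x₀ a' q) = ∏ i, g (a i) (a' i) := by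
  refine (Fintype.prod_of_injective e e.injective _ _ (fun q hq => ?_) fun i => ?_).symm
  · rw [pad_of_notMem_range e x₀ a hq, pad_of_notMem_range e x₀ a' hq, hg]
  · rw [pad_apply, pad_apply]

end

namespace Channel

section

variable {I J S X Y : Type} [Fintype I] [DecidableEq I] [Fintype J] [DecidableEq J] [Fintype S]
  [DecidableEq S] [Fintype X] [DecidableEq X] [Fintype Y] [DecidableEq Y]

/-- The operation that applies `|s⟩ ↦ φ s |w s⟩|d s⟩` and discards `d s` together with the letters
of the word `w s` outside the range of `e`. -/
def unpad (e : I ↪ J) (w : S → J → X) (d : S → Y) (φ : S → ℂ)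
    (h : Function.Injective fun s => (w s, d s)) (hφ : ∀ s, star (φ s) * φ s = 1) :
    Channel S (I → X) :=
  discarding (fun s i => w s (e i)) (fun s => (d s, fun q : {q // q ∉ Set.range e} => w s q)) φ
    (fun s s' hs => h (Prod.ext (funext fun q => by
      by_cases hq : q ∈ Set.range e
      · obtain ⟨i, rfl⟩ := hq
        exact congrFun (congrArg (·.1) hs) i
      · exact congrFun (congrArg (·.2.2) hs) ⟨q, hq⟩) (congrArg (·.2.1) hs))) hφ

theorem liouville_unpad {Z : Type} (e : I ↪ J) {w : S → J → X} {d : S → Y} {φ : S → ℂ}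
    (h : Function.Injective fun s => (w s, d s)) (hφ : ∀ s, star (φ s) * φ s = 1) (f : Z → X)
    {z₀ : Z} {a a' : I → Z} {s s' : S} (hs : w s = fun q => f (pad e z₀ a q))
    (hs' : w s' = fun q => f (pad e z₀ a' q)) (hd : d s = d s') {c : ℂ}
    (hc : φ s * star (φ s') = c) (y y' : I → X) :
    (unpad e w d φ h hφ).liouville (y, y') (s, s')
      = if (y = fun i => f (a i)) ∧ (y' = fun i => f (a' i)) then c else 0 := by
  have hrest : (fun q : {q // q ∉ Set.range e} => f (pad e z₀ a q))
      = fun q : {q // q ∉ Set.range e} => f (pad e z₀ a' q) :=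
    funext fun q => by rw [pad_of_notMem_range e z₀ a q.2, pad_of_notMem_range e z₀ a' q.2]
  refine (liouville_discarding _ _ _ _ _ y y' s s').trans ?_
  simp [hs, hs', hd, pad_apply, hrest, ← hc]

end

end Channel

/-! ### Proper resources simulate relative ones -/

theorem simulates_relative_of_proper {A C D : Type} [Fintype A] [DecidableEq A] [Fintype C]
    [DecidableEq C] [Fintype D] [DecidableEq D] {N : Channel A (C × D)} {f : A → C × D}
    {g : A → A → ℂ} (hN : N.IsMonomial f g) (ω : State A) {m n : ℕ} (hmn : m ≤ n) :
    Simulates (DepthResource.times 1 [(FiniteResource.proper N).pow n])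
      ((FiniteResource.relative N ω).pow m) := by
  obtain ⟨a₀⟩ : Nonempty A := by
    by_contra h
    have := not_nonempty_iff.mp h
    simpa [Matrix.trace] using ω.trace_eq_one
  let e : Fin m ↪ Fin n := Fin.castLEEmb hmn
  let blocks (_ : Unit) (a : (Fin m → A) × (Fin m → Unit)) :
      ((Fin 1 → Fin n → Unit) × (Fin 1 → Fin n → A)) × Unit :=
    ((fun _ _ => (), fun _ => pad e a₀ a.1), ())
  have hsingle (X : Type) : Function.Injective
      fun o : (Fin 1 → Fin n → X) × Unit => (o.1 0, ()) := fun _ _ h =>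
    Prod.ext (funext fun q => Subsingleton.elim 0 q ▸ congrArg Prod.fst h) rfl
  have hblocks (a a') (h : (blocks () a).1.2 = (blocks () a').1.2) : a = a' :=
    Prod.ext (pad_injective e a₀ (congrFun h 0)) (Subsingleton.elim _ _)
  refine Simulates.of_isMonomial (K := Unit) (Keep := Unit) (blocks := blocks) (φ := fun _ _ => 1)
    ((hN.comp_ofEquiv (Equiv.punitProd A)).pow n) ((hN.comp_ofEquiv (Equiv.prodPUnit A)).pow m)
    (fun _ a a' h => hblocks a a' (congrArg (·.1.2) h)) (by simp)
    (.unpad e (fun o => o.1 0) (fun _ => ()) (fun _ => 1) (hsingle C) (by simp))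
    (.unpad e (fun o => o.1 0) (fun _ => ()) (fun _ => 1) (hsingle D) (by simp))
    (fun i c a a' => ?_) (fun _ a a' => ?_) (fun _ a a' => ?_) (fun _ a a' => ?_)
  · have htest : ((FiniteResource.proper N).pow n).test.mat c.1 c.2 = 1 :=
      Finset.prod_eq_one (s := Finset.univ (α := Fin n)) fun l _ => Matrix.one_apply_eq ()
    simp only [one_mul, star_one, Fintype.card_unit, Nat.cast_one, inv_one, Finset.univ_unique,
      Finset.sum_singleton, htest, Steps.testMarginal, partialTrace, Matrix.of_apply]
    by_cases ha : a = a'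
    · subst ha
      exact (if_pos ⟨rfl, rfl, rfl⟩).trans (if_pos rfl).symm
    · exact (if_neg fun h => ha (hblocks a a' (congrArg (·.2.1) h.2.2))).trans (if_neg ha).symm
  · exact (Fintype.prod_unique _).trans (prod_pad e (hN.weight_self a₀) a.1 a'.1)
  · exact Channel.liouville_unpad e (hsingle C) (by simp) (fun x => (f x).1)
      (z₀ := a₀) (a := a.1) (a' := a'.1) rfl rfl rfl (by simp)
  · exact Channel.liouville_unpad e (hsingle D) (by simp) (fun x => (f x).2)
      (z₀ := a₀) (a := a.1) (a' := a'.1) rfl rfl rfl (by simp)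

/-! ### Random shifts and phases -/

section

variable {G L : Type} [AddCommGroup G] {j : ℕ}

/-- The contents of the blocks when Alice sends the data `p` with the key `κ`: the shift key, the
phase key, and the data, in each block shifted by the same key. -/
def twirl (κ : (L → G) × (L → G)) (p : Fin j × L → G) : Fin (j + 2) → L → G :=
  Fin.cons κ.1 (Fin.cons κ.2 fun q l => p (q, l) + κ.1 l)

theorem twirl_succ_succ (κ : (L → G) × (L → G)) (p : Fin j × L → G) (q : Fin j) (l : L) :
    twirl κ p q.succ.succ l = p (q, l) + κ.1 l := rfl

theorem prod_twirl {M : Type} [CommMonoid M] [Fintype L] {g : G → G → M}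
    (hself : ∀ x, g x x = 1) (hadd : ∀ a a' x, g (a + x) (a' + x) = g a a')
    (κ : (L → G) × (L → G)) (p p' : Fin j × L → G) :
    ∏ q, ∏ l, g (twirl κ p q l) (twirl κ p' q l) = ∏ s, g (p s) (p' s) := by
  simp only [Fin.prod_univ_succ (n := j + 1), Fin.prod_univ_succ (n := j), twirl_succ_succ, hadd,
    Fintype.prod_prod_type]
  have h₀ : ∏ l, g (twirl κ p 0 l) (twirl κ p' 0 l) = 1 :=
    Finset.prod_eq_one fun l _ => hself (κ.1 l)
  have h₁ : ∏ l, g (twirl κ p (Fin.succ 0) l) (twirl κ p' (Fin.succ 0) l) = 1 :=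
    Finset.prod_eq_one fun l _ => hself (κ.2 l)
  rw [h₀, h₁, one_mul, one_mul]

end

section

variable {G L : Type} [AddCommGroup G] [Fintype G]

/-- An enumeration of the characters of `G` by the elements of `G`, so that a character can be
sent as a letter. -/
def charLabel (G : Type) [AddCommGroup G] [Fintype G] : G ≃ AddChar G ℂ :=
  Fintype.equivOfCardEq AddChar.card_eq.symm

theorem sum_charLabel [DecidableEq G] (x : G) :
    ∑ z, charLabel G z x = if x = 0 then (Fintype.card G : ℂ) else 0 :=
  ((charLabel G).sum_comp fun ψ => ψ x).trans (AddChar.sum_apply_eq_ite x)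

variable {j : ℕ} [Fintype L]

/-- The phase given to the data `p` in `j` blocks by the key `z`: the characters labelled by `z` are
applied to all blocks alike. -/
def phase (z : L → G) (p : Fin j × L → G) : ℂ :=
  ∏ l, charLabel G (z l) (∑ q, p (q, l))

theorem phase_mul_star (z : L → G) (p p' : Fin j × L → G) :
    phase z p * star (phase z p') = phase z (p - p') := by
  simp only [phase, star_prod, ← Finset.prod_mul_distrib, Pi.sub_apply, Finset.sum_sub_distrib,
    sub_eq_add_neg _ (∑ q, p' (q, _)), AddChar.map_add_eq_mul, AddChar.map_neg_eq_conj,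
    Complex.star_def]

theorem star_phase_mul_self (z : L → G) (p : Fin j × L → G) :
    star (phase z p) * phase z p = 1 := by
  rw [mul_comm, phase_mul_star, sub_self]
  simp [phase]

theorem sum_phase [DecidableEq G] [DecidableEq L] (p : Fin j × L → G) :
    ∑ z, phase z p = if ∀ l, ∑ q, p (q, l) = 0 then (Fintype.card (L → G) : ℂ) else 0 := by
  simp only [phase]
  rw [← Fintype.prod_sum fun (l : L) (z : G) => charLabel G z (∑ q, p (q, l))]
  simp only [sum_charLabel]
  rw [Finset.prod_ite_zero]
  simp

end

section

variable {G L : Type} [AddCommGroup G] [Fintype G] [Fintype L] [DecidableEq L] {j : ℕ}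

theorem sum_phase_sub_eq_zero {p p' : Fin j × L → G} (hp : p ≠ p') {q : Fin j}
    (hoff : ∀ q', q' ≠ q → ∀ l, p (q', l) = p' (q', l)) : ∑ z, phase z (p - p') = 0 := by
  classical
  rw [sum_phase, if_neg]
  refine fun hsum => hp (funext fun ⟨q', l⟩ => ?_)
  by_cases hq : q' = q
  · rw [hq, ← sub_eq_zero, ← hsum l]
    exact (Fintype.sum_eq_single q fun q' hq' => sub_eq_zero.mpr (hoff q' hq' l)).symm
  · exact hoff q' hq l

variable [DecidableEq G]

theorem sum_ite_twirl_eq (p : Fin j × L → G) (i : Fin (j + 2)) (c : L → G) :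
    (∑ κ, if twirl κ p i = c then (1 : ℂ) else 0) = Fintype.card (L → G) := by
  refine Fin.cases ?_ (Fin.cases ?_ fun q => ?_) i
  · change (∑ κ : (L → G) × (L → G), if κ.1 = c then (1 : ℂ) else 0) = _
    rw [Fintype.sum_prod_type_right]
    simp
  · change (∑ κ : (L → G) × (L → G), if κ.2 = c then (1 : ℂ) else 0) = _
    rw [Fintype.sum_prod_type]
    simp
  · have h (κ : (L → G) × (L → G)) :
        twirl κ p q.succ.succ = c ↔ κ.1 = c - fun l => p (q, l) := by
      rw [eq_sub_iff_add_eq']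
      rfl
    simp only [h]
    rw [Fintype.sum_prod_type_right]
    simp

theorem sum_phase_mul_twirl (i : Fin (j + 2)) (c c' : L → G) (p p' : Fin j × L → G) :
    (∑ κ : (L → G) × (L → G), phase κ.2 p * star (phase κ.2 p')
      * if twirl κ p i = c ∧ twirl κ p' i = c' ∧ ∀ q, q ≠ i → twirl κ p q = twirl κ p' q
        then 1 else 0)
      = if p = p' ∧ c = c' then (Fintype.card (L → G) : ℂ) else 0 := by
  simp only [phase_mul_star]
  by_cases hp : p = p'
  · subst hp
    by_cases hc : c = c'
    · subst hc
      simp only [sub_self, implies_true, and_true, and_self, if_true]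
      rw [← sum_ite_twirl_eq p i c]
      simp [phase]
    · rw [if_neg fun h => hc h.2]
      refine Finset.sum_eq_zero fun κ _ => ?_
      rw [if_neg fun h => hc (h.1.symm.trans h.2.1), mul_zero]
  rw [if_neg fun h => hp h.1]
  by_cases hoff : ∀ q l, q.succ.succ ≠ i → p (q, l) = p' (q, l)
  · obtain ⟨⟨q, l⟩, hql⟩ := Function.ne_iff.mp hp
    obtain rfl : q.succ.succ = i := by_contra fun h => hql (hoff q l h)
    have hrest (κ : (L → G) × (L → G)) (q') : q' ≠ q.succ.succ → twirl κ p q' = twirl κ p' q' := by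
      refine Fin.cases (fun _ => rfl) (Fin.cases (fun _ => rfl) fun q' hq' => ?_) q'
      funext l
      rw [twirl_succ_succ, twirl_succ_succ, hoff q' l hq']
    simp only [iff_true_intro (hrest _), and_true]
    rw [Fintype.sum_prod_type]
    refine Finset.sum_eq_zero fun x _ => ?_
    have hz := sum_phase_sub_eq_zero hp (q := q) fun q' hq' l => hoff q' l (by simpa using hq')
    calc _ = (∑ z, phase z (p - p')) * if twirl (x, 0) p q.succ.succ = c
          ∧ twirl (x, 0) p' q.succ.succ = c' then 1 else 0 := (Finset.sum_mul ..).symm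
      _ = 0 := by rw [hz, zero_mul]
  · push Not at hoff
    obtain ⟨q, l, hqi, hql⟩ := hoff
    refine Finset.sum_eq_zero fun κ _ => ?_
    rw [if_neg, mul_zero]
    exact fun h => hql (add_right_cancel (congrFun (h.2.2 _ hqi) l))

end

/-! ### Relative resources simulate proper ones -/

/-- The operation `N` is monomial and takes `|a⟩` to `|h a⟩` for Alice and `|a⟩` for Bob, its
weights `g` are invariant under shifts of the basis, and `unshift x` undoes the effect of a shift
by `x` on Alice's output. -/
structure IsShiftCovariant {G C : Type} [AddCommGroup G] [Fintype G] [DecidableEq G] [Fintype C]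
    [DecidableEq C] (N : Channel G (C × G)) (h : G → C) (g : G → G → ℂ) (unshift : G → C → C) :
    Prop where
  isMonomial : N.IsMonomial (fun a => (h a, a)) g
  weight_add : ∀ a a' x, g (a + x) (a' + x) = g a a'
  unshift_injective : ∀ x, Function.Injective (unshift x)
  unshift_apply : ∀ a x, unshift x (h (a + x)) = h a

section

variable {j b : ℕ}

/-- The data recovered from the received blocks `o` by undoing the shifts with the key `x`. -/
def unshiftBlocks {G C : Type} (unshift : G → C → C) (x : Fin b → G)
    (o : Fin (j + 2) → Fin b → C) : Fin j × Fin b → C :=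
  fun s => unshift (x s.2) (o s.1.succ.succ s.2)

theorem eq_of_unshiftBlocks_eq {G C : Type} {unshift : G → C → C}
    (hinj : ∀ x, Function.Injective (unshift x)) {x : Fin b → G} {o o' : Fin (j + 2) → Fin b → C}
    (h : unshiftBlocks unshift x o = unshiftBlocks unshift x o') (h₀ : o 0 = o' 0)
    (h₁ : o 1 = o' 1) : o = o' :=
  funext <| Fin.cases h₀ <| Fin.cases h₁ fun q => funext fun l =>
    hinj (x l) (congrFun h (q, l))

variable {G C I : Type} [AddCommGroup G] [Fintype G] [DecidableEq G] [Fintype C] [DecidableEq C]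
  [Fintype I] [DecidableEq I]

theorem unshiftBlocks_twirl {N : Channel G (C × G)} {h : G → C} {g : G → G → ℂ}
    {unshift : G → C → C} (hN : IsShiftCovariant N h g unshift) (κ : (Fin b → G) × (Fin b → G))
    (p : Fin j × Fin b → G) :
    unshiftBlocks unshift κ.1 (fun q l => h (twirl κ p q l)) = fun s => h (p s) :=
  funext fun s => hN.unshift_apply (p s) (κ.1 s.2)

/-- Alice's final operation: she undoes the shifts with the key she has kept. -/
def aliceDecoder {unshift : G → C → C} (hinj : ∀ x, Function.Injective (unshift x))
    (e : I ↪ Fin j × Fin b) : Channel ((Fin (j + 2) → Fin b → C) × (Fin b → G)) (I → C) :=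
  .unpad e (fun o => unshiftBlocks unshift o.2 o.1) (fun o => (o.1 0, o.1 1, o.2)) (fun _ => 1)
    (fun o o' h => by
      have hx : o.2 = o'.2 := congrArg (·.2.2.2) h
      refine Prod.ext (eq_of_unshiftBlocks_eq hinj (x := o.2) ?_ (congrArg (·.2.1) h)
        (congrArg (·.2.2.1) h)) hx
      exact (congrArg Prod.fst h).trans (by rw [hx])) (by simp)

/-- Bob's final operation: he undoes the shifts and phases with the keys he has received. -/
def bobDecoder (e : I ↪ Fin j × Fin b) : Channel ((Fin (j + 2) → Fin b → G) × Unit) (I → G) :=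
  .unpad e (fun o => unshiftBlocks (fun x y => y - x) (o.1 0) o.1) (fun o => (o.1 0, o.1 1))
    (fun o => star (phase (o.1 1) (unshiftBlocks (fun x y => y - x) (o.1 0) o.1)))
    (fun o o' h => by
      have hx : o.1 0 = o'.1 0 := congrArg (·.2.1) h
      refine Prod.ext (eq_of_unshiftBlocks_eq (unshift := fun x y : G => y - x)
        (fun _ => sub_left_injective) (x := o.1 0) ?_ hx (congrArg (·.2.2) h)) rfl
      exact (congrArg Prod.fst h).trans (by rw [hx]))
    fun o => by rw [star_star, mul_comm, star_phase_mul_self]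

theorem liouville_aliceDecoder {N : Channel G (C × G)} {h : G → C} {g : G → G → ℂ}
    {unshift : G → C → C} (hN : IsShiftCovariant N h g unshift) (e : I ↪ Fin j × Fin b)
    (κ : (Fin b → G) × (Fin b → G)) (a a' : I → G) (y y' : I → C) :
    (aliceDecoder hN.unshift_injective e).liouville (y, y')
        ((fun q l => h (twirl κ (pad e 0 a) q l), κ.1),
          (fun q l => h (twirl κ (pad e 0 a') q l), κ.1))
      = if (y = fun i => h (a i)) ∧ (y' = fun i => h (a' i)) then 1 else 0 := by
  rw [aliceDecoder]
  refine Channel.liouville_unpad e _ _ h (z₀ := 0) (s := (_, κ.1)) (s' := (_, κ.1)) ?_ ?_ ?_ ?_ y y'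
  · exact unshiftBlocks_twirl hN κ (pad e 0 a)
  · exact unshiftBlocks_twirl hN κ (pad e 0 a')
  · rfl
  · simp

theorem liouville_bobDecoder (e : I ↪ Fin j × Fin b) (κ : (Fin b → G) × (Fin b → G))
    (a a' y y' : I → G) :
    (bobDecoder e).liouville (y, y') ((twirl κ (pad e 0 a), ()), (twirl κ (pad e 0 a'), ()))
      = if y = a ∧ y' = a' then star (phase κ.2 (pad e 0 a)) * phase κ.2 (pad e 0 a') else 0 := by
  have h (p : Fin j × Fin b → G) :
      unshiftBlocks (fun x y => y - x) κ.1 (twirl κ p) = p :=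
    funext fun s => add_sub_cancel_right _ _
  rw [bobDecoder]
  refine Channel.liouville_unpad e _ _ id (z₀ := 0) (s := (twirl κ (pad e 0 a), ()))
    (s' := (twirl κ (pad e 0 a'), ())) ?_ ?_ ?_ ?_ y y'
  · exact h (pad e 0 a)
  · exact h (pad e 0 a')
  · rfl
  · rw [star_star]
    exact congrArg₂ (fun p p' => star (phase κ.2 p) * phase κ.2 p') (h _) (h _)

end

theorem pow_maximallyMixed_apply (A : Type) [Fintype A] [DecidableEq A] [Nonempty A] (n : ℕ)
    (c c' : Fin n → A) : ((State.maximallyMixed A).pow n).mat c c'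
      = if c = c' then (Fintype.card (Fin n → A) : ℂ)⁻¹ else 0 := by
  change ∏ l, ((Fintype.card A : ℂ)⁻¹ • (1 : Matrix A A ℂ)) (c l) (c' l) = _
  simp only [Matrix.smul_apply, Matrix.one_apply, smul_eq_mul, mul_ite, mul_one, mul_zero]
  rw [Finset.prod_ite_zero]
  simp [funext_iff]

section

variable {G C : Type} [AddCommGroup G] [Fintype G] [DecidableEq G] [Fintype C] [DecidableEq C]
  {N : Channel G (C × G)}

theorem sum_phase_mul_testMarginal_twirl {j b : ℕ} (i : Fin (j + 2))
    (c : (Fin b → G) × (Fin b → G)) (p p' : Fin j × Fin b → G) :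
    (Fintype.card ((Fin b → G) × (Fin b → G)) : ℂ)⁻¹ *
      ∑ κ : (Fin b → G) × (Fin b → G), phase κ.2 p * star (phase κ.2 p')
        * Steps.testMarginal ((FiniteResource.relative N (State.maximallyMixed G)).pow b)
          (S := ((Fin (j + 2) → Fin b → G) × (Fin (j + 2) → Fin b → Unit)) × (Fin b → G))
          Prod.fst Prod.snd i c
          (((twirl κ p, fun _ _ => ()), κ.1), ((twirl κ p', fun _ _ => ()), κ.1))
      = if p = p' then ((State.maximallyMixed G).pow b).mat c.1 c.2 else 0 := by
  have hmarginal (κ : (Fin b → G) × (Fin b → G)) :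
      Steps.testMarginal ((FiniteResource.relative N (State.maximallyMixed G)).pow b)
          (S := ((Fin (j + 2) → Fin b → G) × (Fin (j + 2) → Fin b → Unit)) × (Fin b → G))
          Prod.fst Prod.snd i c
          (((twirl κ p, fun _ _ => ()), κ.1), ((twirl κ p', fun _ _ => ()), κ.1))
        = if twirl κ p i = c.1 ∧ twirl κ p' i = c.2
          ∧ ∀ q, q ≠ i → twirl κ p q = twirl κ p' q then 1 else 0 := by
    by_cases hκ : twirl κ p i = c.1 ∧ twirl κ p' i = c.2
        ∧ ∀ q, q ≠ i → twirl κ p q = twirl κ p' q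
    · exact (if_pos ⟨hκ.1, hκ.2.1, Prod.ext (funext fun q => hκ.2.2 q q.2) rfl⟩).trans
        (if_pos hκ).symm
    · exact (if_neg fun hs => hκ ⟨hs.1, hs.2.1, fun q hq =>
        congrFun (congrArg Prod.fst hs.2.2) ⟨q, hq⟩⟩).trans (if_neg hκ).symm
  simp only [hmarginal]
  rw [sum_phase_mul_twirl, pow_maximallyMixed_apply, Fintype.card_prod]
  by_cases hp : p = p' <;> by_cases hc : c.1 = c.2 <;> simp [hp, hc]

theorem simulates_proper_of_relative {h : G → C} {g : G → G → ℂ} {unshift : G → C → C}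
    (hN : IsShiftCovariant N h g unshift) {m j b : ℕ} (hm : m ≤ j * b) :
    Simulates
      (DepthResource.times (j + 2) [(FiniteResource.relative N (State.maximallyMixed G)).pow b])
      ((FiniteResource.proper N).pow m) := by
  let e : Fin m ↪ Fin j × Fin b := (Fin.castLEEmb hm).trans finProdFinEquiv.symm.toEmbedding
  let data (a : (Fin m → Unit) × (Fin m → G)) : Fin j × Fin b → G := pad e 0 a.2
  have hdata : Function.Injective data := fun a a' ha =>
    Prod.ext (Subsingleton.elim _ _) (pad_injective e 0 ha)
  refine Simulates.of_isMonomial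
    (r := (FiniteResource.relative N (State.maximallyMixed G)).pow b)
    (K := (Fin b → G) × (Fin b → G)) (Keep := Fin b → G)
    (blocks := fun κ a => ((twirl (G := G) κ (data a), fun _ _ => ()), κ.1))
    (φ := fun κ a => phase κ.2 (data a))
    ((hN.isMonomial.comp_ofEquiv (Equiv.prodPUnit G)).pow b)
    ((hN.isMonomial.comp_ofEquiv (Equiv.punitProd G)).pow m) (fun κ a a' ha => ?_)
    (fun κ a => star_phase_mul_self κ.2 _) (aliceDecoder hN.unshift_injective e)
    (bobDecoder (G := G) e)
    (fun i c a a' => ?_) (fun κ a a' => ?_) (fun κ a a' => ?_) (fun κ a a' => ?_)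
  · refine hdata (funext fun ⟨q, l⟩ => add_right_cancel (G := G) (b := κ.1 l) ?_)
    exact congrFun (congrFun (congrArg (·.1.1) ha) q.succ.succ) l
  · exact (sum_phase_mul_testMarginal_twirl (G := G) i c (data a) (data a')).trans
      (if_congr hdata.eq_iff rfl rfl)
  · exact (prod_twirl hN.isMonomial.weight_self hN.weight_add κ (data a) (data a')).trans
      (prod_pad e (hN.isMonomial.weight_self 0) a.2 a'.2)
  · exact liouville_aliceDecoder hN e κ a.2 a'.2
  · exact liouville_bobDecoder (G := G) e κ a.2 a'.2

end

/-! ### Asymptotic equivalence -/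

section

variable (d : ℕ) [NeZero d]

theorem isShiftCovariant_idChannel :
    IsShiftCovariant (idChannel d) (fun _ => ()) (fun _ _ => 1) fun _ c => c where
  isMonomial := by
    rintro ⟨_, b⟩ ⟨_, b'⟩ a a'
    rw [idChannel, Channel.liouville_ofIsometry]
    by_cases h₁ : b = a <;> by_cases h₂ : b' = a' <;> simp [h₁, h₂]
  weight_add _ _ _ := rfl
  unshift_injective _ _ _ h := h
  unshift_apply _ _ := rfl

theorem isShiftCovariant_coherentChannel :
    IsShiftCovariant (coherentChannel d) (fun a => a) (fun _ _ => 1) fun x c => c - x where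
  isMonomial := by
    rintro ⟨c, b⟩ ⟨c', b'⟩ a a'
    rw [coherentChannel, Channel.liouville_ofIsometry]
    by_cases h₁ : c = a ∧ b = a <;> by_cases h₂ : c' = a' ∧ b' = a' <;> simp [h₁, h₂]
  weight_add _ _ _ := rfl
  unshift_injective _ := sub_left_injective
  unshift_apply := add_sub_cancel_right

theorem isShiftCovariant_classicalChannel :
    IsShiftCovariant (classicalChannel d) (fun _ => ()) (fun a a' => if a = a' then 1 else 0)
      fun _ c => c where
  isMonomial := by
    rintro ⟨_, b⟩ ⟨_, b'⟩ a a'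
    rw [Channel.liouville_apply]
    change ∑ y : Fin d, (if b = y ∧ a = y then (1 : ℂ) else 0)
      * star (if b' = y ∧ a' = y then (1 : ℂ) else 0) = _
    rw [Fintype.sum_eq_single b fun y hy => by simp [hy.symm]]
    grind [star_one, star_zero]
  weight_add a a' x := by simp
  unshift_injective _ _ _ h := h
  unshift_apply _ _ := rfl

end

theorem exists_floor_le_mul_div {δ : ℝ} (hδ : 0 < δ) :
    ∃ j n₀ : ℕ, ∀ n, n₀ ≤ n → ⌊(1 - δ) * n⌋₊ ≤ j * (n / (j + 2)) := by
  obtain ⟨j, hj⟩ := exists_nat_ge (4 / δ)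
  obtain ⟨n₀, hn₀⟩ := exists_nat_ge (2 * j / δ)
  refine ⟨j, n₀, fun n hn => Nat.floor_le_of_le ?_⟩
  have hjδ : 4 ≤ j * δ := (div_le_iff₀ hδ).mp hj
  have hnδ : 2 * j ≤ n * δ :=
    ((div_le_iff₀ hδ).mp hn₀).trans (mul_le_mul_of_nonneg_right (by exact_mod_cast hn) hδ.le)
  have hdiv : (n : ℝ) ≤ (j + 2) * ((n / (j + 2) : ℕ) + 1) := by
    exact_mod_cast (Nat.lt_mul_div_succ n (by omega)).le
  have hjn : 4 * (n : ℝ) ≤ j * δ * n := by gcongr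
  push_cast
  refine le_of_mul_le_mul_left (a := (j + 2 : ℝ)) ?_ (by positivity)
  calc (j + 2) * ((1 - δ) * (n : ℝ)) ≤ j * n - (j + 2) * j := by nlinarith
    _ ≤ j * ((j + 2) * ((n / (j + 2) : ℕ) + 1)) - (j + 2) * j := by gcongr
    _ = (j + 2) * (j * (n / (j + 2) : ℕ)) := by ring

theorem equivalent_of_isShiftCovariant {G C : Type} [AddCommGroup G] [Fintype G] [DecidableEq G]
    [Fintype C] [DecidableEq C] {N : Channel G (C × G)} {h : G → C} {g : G → G → ℂ}
    {unshift : G → C → C} (hN : IsShiftCovariant N h g unshift) :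
    (iid (FiniteResource.relative N (State.maximallyMixed G))).Equivalent
      (iid (FiniteResource.proper N)) := by
  constructor
  · refine ResourceSequence.ge_of_simulates fun δ hδ => ?_
    obtain ⟨j, n₀, hj⟩ := exists_floor_le_mul_div hδ
    exact ⟨j + 2, by omega, n₀, fun n hn => simulates_proper_of_relative hN (hj n hn)⟩
  · refine ResourceSequence.ge_of_simulates fun δ hδ => ⟨1, one_pos, 0, fun n _ => ?_⟩
    refine simulates_relative_of_proper hN.isMonomial (State.maximallyMixed G) ?_
    rw [Nat.div_one]
    exact Nat.floor_le_of_le (mul_le_of_le_one_left n.cast_nonneg (by linarith))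

end

end ResourceTheory

open ResourceTheory in
theorem mainTheorem2_general (d : ℕ) [NeZero d] :
    (iid (.relative (idChannel d) (.maximallyMixed (Fin d)))).Equivalent
        (iid (.proper (idChannel d))) ∧
      (iid (.relative (coherentChannel d) (.maximallyMixed (Fin d)))).Equivalent
        (iid (.proper (coherentChannel d))) ∧
      (iid (.relative (classicalChannel d) (.maximallyMixed (Fin d)))).Equivalent
        (iid (.proper (classicalChannel d))) :=
  ⟨equivalent_of_isShiftCovariant (isShiftCovariant_idChannel d),
    equivalent_of_isShiftCovariant (isShiftCovariant_coherentChannel d),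
    equivalent_of_isShiftCovariant (isShiftCovariant_classicalChannel d)⟩

theorem mainTheorem2 :
    ResourceTheory.qubitRel.Equivalent ResourceTheory.qubit ∧
    ResourceTheory.cobitRel.Equivalent ResourceTheory.cobit ∧
    ResourceTheory.cbitRel.Equivalent ResourceTheory.cbit :=
  mainTheorem2_general 2
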